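/- Let $N\ge 3$ and let $\Omega\subset\mathbb{R}^N$ be a bounded Lipschitz domain (open, connected, nonempty, and near each boundary point, in suitable rectangular coordinates $(x,z)\in\mathbb{R}^{N-1}\times\mathbb{R}$, the region above the graph of a Lipschitz function). Let $\Gamma=\partial\Omega$ carry the $(N-1)$-dimensional Hausdorff measure $\sigma$, and let $\Gamma_1,\Gamma_2\subset\Gamma$ satisfy $\Gamma_1\cap\Gamma_2=\emptyset$, $\overline{\Gamma}_1\cup\Gamma_2=\Gamma_1\cup\overline{\Gamma}_2=\Gamma$ and $\sigma(\Gamma_1)>0$. Let $H^1(\Omega)=W^{1,2}(\Omega)$, let $H^{1/2}(\Gamma)\subset L^2(\Gamma)$ be the space of traces of functions in $H^1(\Omega)$ with the quotient norm, let $H^{1/2}(\Gamma_1)$ be the space of restrictions to $\Gamma_1$ of elements of $H^{1/2}(\Gamma)$, let $\widetilde H^{1/2}(\Gamma_2)=\{g\in H^{1/2}(\Gamma):\operatorname{supp} g\subset\overline{\Gamma}_2\}$, and let $H^{-1/2}(\Gamma_2)=(\widetilde H^{1/2}(\Gamma_2))^*$. Let $f_1\in H^{1/2}(\Gamma_1)$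 and $f_2\in H^{-1/2}(\Gamma_2)$. Let $(\mu_n)\subset L^\infty(\Omega)$ be a sequence that either has bounded total variation, $\sup_n\int_\Omega|\mu_n|\,dx<\infty$, or converges weakly-$*$ to some finite signed Radon measure $\mu$, that is, $\int_\Omega g\,\mu_n\,dx\to\int_\Omega g\,d\mu$ for all $g\in C(\overline\Omega)$. For each $n$ let $u_n\in H^1(\Omega)$ be a solution of $$-\Delta u_n=\mu_n\ \text{in }\Omega,\qquad u_n=f_1\ \text{on }\Gamma_1,\qquad \frac{\partial u_n}{\partial\hat n}=f_2\ \text{on }\Gamma_2,$$ that is, the trace of $u_n$ equals $f_1$ $\sigma$-almost everywhere on $\Gamma_1$, and $$\int_\Omega\nabla u_n\cdot\nabla v\,dx=\int_\Omega v\,\mu_n\,dx+\langle f_2,v|_\Gamma\rangle_{\Gamma_2}$$ for all $v\in H^1(\Omega)$ with trace $v|_\Gamma\in\widetilde H^{1/2}(\Gamma_2)$. Then for every $q$ with $1\le q<\frac{N}{N-1}$ the sequence $(u_n)$ is bounded in $W^{1,q}(\Omega)$: every $u_n$ is in $W^{1,q}(\Omega)$, and there is a constant $C$ with $\|u_n\|_{L^q(\Omega)}+\sum_{i=1}^N\|\partial_i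 u_n\|_{L^q(\Omega)}\le C$ for all $n$. -/

import Mathlib

open MeasureTheory Filter Topology Set
open scoped ENNReal NNReal ContDiff

noncomputable section

namespace MixedPoisson

/-- Euclidean space `ℝ^N`. -/
abbrev E (N : ℕ) := EuclideanSpace ℝ (Fin N)

/-- Lipschitz open sets: near every boundary point `P` there are rectangular coordinates
`(x, z) ∈ ℝ^(N-1) × ℝ` in which the set is the region above the graph of a Lipschitz function.
(The origin of the coordinates is kept: a translation can be absorbed into the function.) -/
def IsLipschitzSet {N : ℕ} (Ω : Set (E N)) : Prop :=
  ∀ P ∈ frontier Ω,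
    ∃ (A : E N ≃ₗᵢ[ℝ] WithLp 2 (E (N - 1) × ℝ)) (U : Set (E N)) (γ : E (N - 1) → ℝ) (L : ℝ≥0),
      IsOpen U ∧ P ∈ U ∧ LipschitzWith L γ ∧
        U ∩ Ω = U ∩ {y | γ (A y).fst < (A y).snd}

/-- Bounded Lipschitz domains (nonempty, open, connected). -/
structure IsBoundedLipschitzDomain {N : ℕ} (Ω : Set (E N)) : Prop where
  isOpen : IsOpen Ω
  isConnected : IsConnected Ω
  isBounded : Bornology.IsBounded Ω
  isLipschitz : IsLipschitzSet Ω

/-- The surface measure of `∂Ω`: the `(N-1)`-dimensional Hausdorff measure on the boundary. -/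
def surf {N : ℕ} (Ω : Set (E N)) : Measure (E N) :=
  (Measure.hausdorffMeasure ((N : ℝ) - 1)).restrict (frontier Ω)

/-- The decomposition of the boundary into a Dirichlet part `Γ₁` and a Neumann part `Γ₂`. -/
structure IsBoundaryDecomposition {N : ℕ} (Ω Γ₁ Γ₂ : Set (E N)) : Prop where
  disjoint : Disjoint Γ₁ Γ₂
  closure_left : closure Γ₁ ∪ Γ₂ = frontier Ω
  closure_right : Γ₁ ∪ closure Γ₂ = frontier Ω

/-- `G` is the weak gradient of `u` in `Ω`. -/
structure HasWeakGradient {N : ℕ} (Ω : Set (E N)) (u : E N → ℝ) (G : E N → E N) : Prop where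
  locInt : LocallyIntegrableOn u Ω
  locIntGrad : LocallyIntegrableOn G Ω
  eq : ∀ φ : E N → ℝ, ContDiff ℝ ∞ φ → HasCompactSupport φ → tsupport φ ⊆ Ω → ∀ i : Fin N,
    ∫ x in Ω, u x * fderiv ℝ φ x (EuclideanSpace.single i 1) = - ∫ x in Ω, G x i * φ x

/-- The Sobolev space `W^{1,p}(Ω)`. -/
def MemW1 {N : ℕ} (Ω : Set (E N)) (p : ℝ≥0∞) (u : E N → ℝ) : Prop :=
  MemLp u p (volume.restrict Ω) ∧
    ∃ G, HasWeakGradient Ω u G ∧ MemLp G p (volume.restrict Ω)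

/-- The norm `‖u‖_p + ∑ᵢ ‖∂ᵢ u‖_p` of `W^{1,p}(Ω)`. The weak gradient is unique up to null sets, so
the infimum is the value at the weak gradient; it is `∞` if `u` has no weak gradient. -/
def w1Norm {N : ℕ} (Ω : Set (E N)) (p : ℝ≥0∞) (u : E N → ℝ) : ℝ≥0∞ :=
  ⨅ (G : E N → E N) (_ : HasWeakGradient Ω u G),
    eLpNorm u p (volume.restrict Ω) + ∑ i, eLpNorm (fun x => G x i) p (volume.restrict Ω)

/-- `g ∈ L²(∂Ω)` is the trace of `u ∈ H¹(Ω) = W^{1,2}(Ω)` on `∂Ω`: the trace operator is the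
continuous extension of `φ ↦ φ|_{∂Ω}` from `C¹(Ω̄)` to `H¹(Ω)`. -/
def HasTrace {N : ℕ} (Ω : Set (E N)) (u : E N → ℝ) (g : Lp ℝ 2 (surf Ω)) : Prop :=
  MemW1 Ω 2 u ∧ ∃ φ : ℕ → E N → ℝ, (∀ k, ContDiff ℝ 1 (φ k)) ∧
    Tendsto (fun k => w1Norm Ω 2 (fun x => φ k x - u x)) atTop (𝓝 0) ∧
    Tendsto (fun k => eLpNorm (fun x => φ k x - g x) 2 (surf Ω)) atTop (𝓝 0)

lemma integrable_smul_test {N : ℕ} {Ω : Set (E N)} {u : E N → ℝ}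
    (hu : LocallyIntegrableOn u Ω) {ψ : E N → ℝ}
    (hψ : Continuous ψ) (hc : HasCompactSupport ψ) (hs : tsupport ψ ⊆ Ω) :
    Integrable (fun x => u x * ψ x) (volume.restrict Ω) := by
  have hK : IsCompact (tsupport ψ) := hc
  have h1 : IntegrableOn u (tsupport ψ) volume := hu.integrableOn_compact_subset hs hK
  have h2 : IntegrableOn (fun x => u x * ψ x) (tsupport ψ) volume :=
    h1.mul_continuousOn hψ.continuousOn hK
  have h3 : Integrable (fun x => u x * ψ x) volume :=
    (integrableOn_iff_integrable_of_support_subset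
      (fun x hx => subset_tsupport ψ (by
        intro h0
        apply hx
        simp [h0]))).1 h2
  exact h3.restrict

lemma integrable_left {N : ℕ} {Ω : Set (E N)} {u : E N → ℝ}
    (h : LocallyIntegrableOn u Ω) {φ : E N → ℝ} (h1 : ContDiff ℝ ∞ φ)
    (h2 : HasCompactSupport φ) (h3 : tsupport φ ⊆ Ω) (i : Fin N) :
    Integrable (fun x => u x * fderiv ℝ φ x (EuclideanSpace.single i 1))
      (volume.restrict Ω) :=
  integrable_smul_test h
    ((h1.continuous_fderiv (by simp)).clm_apply continuous_const)
    (h2.fderiv_apply (𝕜 := ℝ) _) ((tsupport_fderiv_apply_subset ℝ _).trans h3)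

lemma locallyIntegrableOn_coord {N : ℕ} {Ω : Set (E N)} {G : E N → E N}
    (h : LocallyIntegrableOn G Ω) (i : Fin N) : LocallyIntegrableOn (fun x => G x i) Ω := by
  intro x hx
  obtain ⟨t, ht, hG⟩ := h x hx
  exact ⟨t, ht, (EuclideanSpace.proj i : E N →L[ℝ] ℝ).integrable_comp hG⟩

lemma integrable_right {N : ℕ} {Ω : Set (E N)} {G : E N → E N}
    (h : LocallyIntegrableOn G Ω) {φ : E N → ℝ} (h1 : ContDiff ℝ ∞ φ)
    (h2 : HasCompactSupport φ) (h3 : tsupport φ ⊆ Ω) (i : Fin N) :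
    Integrable (fun x => G x i * φ x) (volume.restrict Ω) :=
  integrable_smul_test (locallyIntegrableOn_coord h i) h1.continuous h2 h3

lemma HasWeakGradient.add {N : ℕ} {Ω : Set (E N)} {u v : E N → ℝ} {G H : E N → E N}
    (hu : HasWeakGradient Ω u G) (hv : HasWeakGradient Ω v H) :
    HasWeakGradient Ω (fun x => u x + v x) (fun x => G x + H x) where
  locInt := hu.locInt.add hv.locInt
  locIntGrad := hu.locIntGrad.add hv.locIntGrad
  eq φ h1 h2 h3 i := by
    simp only [add_mul, PiLp.add_apply]
    rw [integral_add (integrable_left hu.locInt h1 h2 h3 i) (integrable_left hv.locInt h1 h2 h3 i),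
      integral_add (integrable_right hu.locIntGrad h1 h2 h3 i)
        (integrable_right hv.locIntGrad h1 h2 h3 i), hu.eq φ h1 h2 h3 i, hv.eq φ h1 h2 h3 i]
    ring

lemma HasWeakGradient.const_smul {N : ℕ} {Ω : Set (E N)} {u : E N → ℝ} {G : E N → E N}
    (hu : HasWeakGradient Ω u G) (c : ℝ) :
    HasWeakGradient Ω (fun x => c * u x) (fun x => c • G x) where
  locInt := hu.locInt.smul c
  locIntGrad := hu.locIntGrad.smul c
  eq φ h1 h2 h3 i := by
    simp only [mul_assoc, PiLp.smul_apply, smul_eq_mul]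
    rw [integral_const_mul, integral_const_mul, hu.eq φ h1 h2 h3 i]
    ring

lemma hasWeakGradient_zero {N : ℕ} (Ω : Set (E N)) :
    HasWeakGradient Ω (fun _ => 0) (fun _ => 0) where
  locInt := locallyIntegrableOn_zero
  locIntGrad := locallyIntegrableOn_zero
  eq φ h1 h2 h3 i := by simp

lemma w1Norm_zero {N : ℕ} (Ω : Set (E N)) (p : ℝ≥0∞) : w1Norm Ω p (fun _ => 0) = 0 := by
  refine le_antisymm (iInf₂_le_of_le _ (hasWeakGradient_zero Ω) ?_) zero_le
  simp

lemma w1Norm_add_le {N : ℕ} {Ω : Set (E N)} {p : ℝ≥0∞} (hp : 1 ≤ p) (u v : E N → ℝ) :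
    w1Norm Ω p (fun x => u x + v x) ≤ w1Norm Ω p u + w1Norm Ω p v := by
  rw [w1Norm, w1Norm, w1Norm]
  simp only [ENNReal.iInf_add, ENNReal.add_iInf]
  refine le_iInf₂ fun H hH => le_iInf₂ fun G hG => ?_
  refine iInf₂_le_of_le _ (hG.add hH) ?_
  rw [add_add_add_comm, ← Finset.sum_add_distrib]
  refine add_le_add
    (eLpNorm_add_le hG.locInt.aestronglyMeasurable hH.locInt.aestronglyMeasurable hp)
    (Finset.sum_le_sum fun i _ => ?_)
  exact eLpNorm_add_le (locallyIntegrableOn_coord hG.locIntGrad i).aestronglyMeasurable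
    (locallyIntegrableOn_coord hH.locIntGrad i).aestronglyMeasurable hp

lemma w1Norm_const_mul_le {N : ℕ} {Ω : Set (E N)} {p : ℝ≥0∞} (c : ℝ) (u : E N → ℝ) :
    w1Norm Ω p (fun x => c * u x) ≤ ‖c‖ₑ * w1Norm Ω p u := by
  rcases eq_or_ne c 0 with rfl | hc
  · simp [w1Norm_zero]
  have hc' : ‖c‖ₑ ≠ 0 := by simpa using hc
  rw [w1Norm, w1Norm]
  simp only [ENNReal.mul_iInf_of_ne hc' enorm_ne_top]
  refine le_iInf₂ fun G hG => iInf₂_le_of_le _ (hG.const_smul c) ?_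
  rw [mul_add, Finset.mul_sum]
  refine add_le_add (le_of_eq (eLpNorm_const_smul c u p _)) (Finset.sum_le_sum fun i _ => ?_)
  exact le_of_eq (eLpNorm_const_smul c (fun x => G x i) p _)

lemma MemW1.add {N : ℕ} {Ω : Set (E N)} {p : ℝ≥0∞} {u v : E N → ℝ}
    (hu : MemW1 Ω p u) (hv : MemW1 Ω p v) : MemW1 Ω p (fun x => u x + v x) := by
  obtain ⟨hu, G, hG, hG'⟩ := hu
  obtain ⟨hv, H, hH, hH'⟩ := hv
  exact ⟨hu.add hv, _, hG.add hH, hG'.add hH'⟩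

lemma MemW1.const_mul {N : ℕ} {Ω : Set (E N)} {p : ℝ≥0∞} {u : E N → ℝ}
    (hu : MemW1 Ω p u) (c : ℝ) : MemW1 Ω p (fun x => c * u x) := by
  obtain ⟨hu, G, hG, hG'⟩ := hu
  exact ⟨hu.const_mul c, _, hG.const_smul c, hG'.const_smul c⟩

lemma HasTrace.add {N : ℕ} {Ω : Set (E N)} {u v : E N → ℝ} {g h : Lp ℝ 2 (surf Ω)}
    (hu : HasTrace Ω u g) (hv : HasTrace Ω v h) : HasTrace Ω (fun x => u x + v x) (g + h) := by
  obtain ⟨hu, φ, hφ, hφu, hφg⟩ := hu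
  obtain ⟨hv, ψ, hψ, hψv, hψh⟩ := hv
  refine ⟨hu.add hv, fun k x => φ k x + ψ k x, fun k => (hφ k).add (hψ k), ?_, ?_⟩
  · refine tendsto_of_tendsto_of_tendsto_of_le_of_le tendsto_const_nhds
      (by simpa using hφu.add hψv) (fun _ => zero_le) (fun k => ?_)
    simp only [add_sub_add_comm]
    exact w1Norm_add_le (by norm_num) _ _
  · refine tendsto_of_tendsto_of_tendsto_of_le_of_le tendsto_const_nhds
      (by simpa using hφg.add hψh) (fun _ => zero_le) (fun k => ?_)
    have hae : (fun x => φ k x + ψ k x - (g + h : Lp ℝ 2 (surf Ω)) x) =ᵐ[surf Ω]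
        (fun x => φ k x - g x) + (fun x => ψ k x - h x) := by
      filter_upwards [Lp.coeFn_add g h] with x hx
      simp only [hx, Pi.add_apply, add_sub_add_comm]
    refine (eLpNorm_congr_ae hae).trans_le (eLpNorm_add_le ?_ ?_ (by norm_num))
    · exact (hφ k).continuous.aestronglyMeasurable.sub (Lp.aestronglyMeasurable g)
    · exact (hψ k).continuous.aestronglyMeasurable.sub (Lp.aestronglyMeasurable h)

lemma HasTrace.const_smul {N : ℕ} {Ω : Set (E N)} {u : E N → ℝ} {g : Lp ℝ 2 (surf Ω)}
    (hu : HasTrace Ω u g) (c : ℝ) : HasTrace Ω (fun x => c * u x) (c • g) := by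
  obtain ⟨hu, φ, hφ, hφu, hφg⟩ := hu
  refine ⟨hu.const_mul c, fun k x => c * φ k x, fun k => contDiff_const.mul (hφ k), ?_, ?_⟩
  · refine tendsto_of_tendsto_of_tendsto_of_le_of_le tendsto_const_nhds
      (by simpa using ENNReal.Tendsto.const_mul hφu (Or.inr (enorm_ne_top (x := c))))
      (fun _ => zero_le) (fun k => ?_)
    simp only [← mul_sub]
    exact w1Norm_const_mul_le c _
  · refine tendsto_of_tendsto_of_tendsto_of_le_of_le tendsto_const_nhds
      (by simpa using ENNReal.Tendsto.const_mul hφg (Or.inr (enorm_ne_top (x := c))))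
      (fun _ => zero_le) (fun k => ?_)
    have hae : (fun x => c * φ k x - (c • g : Lp ℝ 2 (surf Ω)) x) =ᵐ[surf Ω]
        c • (fun x => φ k x - g x) := by
      filter_upwards [Lp.coeFn_smul c g] with x hx
      simp [hx, mul_sub]
    exact ((eLpNorm_congr_ae hae).trans (eLpNorm_const_smul c _ _ _)).le

lemma hasTrace_zero {N : ℕ} (Ω : Set (E N)) : HasTrace Ω (fun _ => 0) 0 := by
  refine ⟨⟨MemLp.zero', _, hasWeakGradient_zero Ω, MemLp.zero'⟩, fun _ _ => 0,
    fun _ => contDiff_const, ?_, ?_⟩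
  · simp [w1Norm_zero]
  · have hae : (fun x => (0 : ℝ) - (0 : Lp ℝ 2 (surf Ω)) x) =ᵐ[surf Ω] fun _ => 0 := by
      filter_upwards [Lp.coeFn_zero ℝ 2 (surf Ω)] with x hx
      rw [hx, Pi.zero_apply, sub_zero]
    simp only [eLpNorm_congr_ae hae, eLpNorm_zero']
    exact tendsto_const_nhds

/-- The space `H^{1/2}(∂Ω)`: the traces on `∂Ω` of the functions in `H¹(Ω)`. -/
def HHalf {N : ℕ} (Ω : Set (E N)) : Submodule ℝ (Lp ℝ 2 (surf Ω)) where
  carrier := {g | ∃ u, HasTrace Ω u g}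
  zero_mem' := ⟨_, hasTrace_zero Ω⟩
  add_mem' := fun ⟨_, hu⟩ ⟨_, hv⟩ => ⟨_, hu.add hv⟩
  smul_mem' := fun c _ ⟨_, hu⟩ => ⟨_, hu.const_smul c⟩

/-- The norm of `H^{1/2}(∂Ω)`: the least `H¹(Ω)` norm of a function with the given trace. -/
def hHalfNorm {N : ℕ} (Ω : Set (E N)) (g : Lp ℝ 2 (surf Ω)) : ℝ≥0∞ :=
  ⨅ (u : E N → ℝ) (_ : HasTrace Ω u g), w1Norm Ω 2 u

/-- `f ∈ H^{1/2}(Γ₁)`: on `Γ₁`, `f` is the restriction of an element of `H^{1/2}(∂Ω)`. -/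
def MemHHalfOn {N : ℕ} (Ω Γ₁ : Set (E N)) (f : E N → ℝ) : Prop :=
  ∃ g ∈ HHalf Ω, g =ᵐ[(surf Ω).restrict Γ₁] f

/-- The space `H̃^{1/2}(Γ₂)`: the elements of `H^{1/2}(∂Ω)` with support in the closure of `Γ₂`,
that is, vanishing almost everywhere outside this closed set. -/
def HTildeHalf {N : ℕ} (Ω Γ₂ : Set (E N)) : Submodule ℝ (Lp ℝ 2 (surf Ω)) where
  carrier := {g | g ∈ HHalf Ω ∧ ∀ᵐ x ∂(surf Ω), x ∉ closure Γ₂ → g x = 0}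
  zero_mem' := by
    refine ⟨(HHalf Ω).zero_mem, ?_⟩
    filter_upwards [Lp.coeFn_zero ℝ 2 (surf Ω)] with x hx _
    rw [hx, Pi.zero_apply]
  add_mem' := by
    rintro g h ⟨hg, hg'⟩ ⟨hh, hh'⟩
    refine ⟨(HHalf Ω).add_mem hg hh, ?_⟩
    filter_upwards [Lp.coeFn_add g h, hg', hh'] with x hx h1 h2 hxc
    rw [hx, Pi.add_apply, h1 hxc, h2 hxc, add_zero]
  smul_mem' := by
    rintro c g ⟨hg, hg'⟩
    refine ⟨(HHalf Ω).smul_mem c hg, ?_⟩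
    filter_upwards [Lp.coeFn_smul c g, hg'] with x hx h1 hxc
    simp [hx, h1 hxc]

/-- The space `H^{-1/2}(Γ₂)`: the dual space of `H̃^{1/2}(Γ₂)`, that is, the linear functionals
that are bounded for the norm of `H^{1/2}(∂Ω)`. -/
structure HNegHalf {N : ℕ} (Ω Γ₂ : Set (E N)) where
  toLinearMap : HTildeHalf Ω Γ₂ →ₗ[ℝ] ℝ
  bounded : ∃ C : ℝ≥0, ∀ h : HTildeHalf Ω Γ₂, ‖toLinearMap h‖ₑ ≤ C * hHalfNorm Ω h

/-- `u ∈ H¹(Ω)` is a solution of the mixed problem `-Δu = ρ` in `Ω`, `u = f₁` on `Γ₁`,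
`∂u/∂n = f₂` on `Γ₂`. The Dirichlet condition is understood through the trace. The equation and
the Neumann condition (equality in `H^{-1/2}(Γ₂)`) are expressed together by Green's formula, for
all `v ∈ H¹(Ω)` whose trace `h` is in `H̃^{1/2}(Γ₂)`; test functions with `h = 0` give the
equation in `Ω`. -/
structure IsMixedSolution {N : ℕ} (Ω Γ₁ Γ₂ : Set (E N)) (ρ f₁ : E N → ℝ) (f₂ : HNegHalf Ω Γ₂)
    (u : E N → ℝ) : Prop where
  memH1 : MemW1 Ω 2 u
  dirichlet : ∃ g : Lp ℝ 2 (surf Ω), HasTrace Ω u g ∧ g =ᵐ[(surf Ω).restrict Γ₁] f₁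
  weak : ∃ G, HasWeakGradient Ω u G ∧
    ∀ (v : E N → ℝ) (H : E N → E N) (h : HTildeHalf Ω Γ₂),
      HasWeakGradient Ω v H → HasTrace Ω v h →
        ∫ x in Ω, inner ℝ (G x) (H x) = (∫ x in Ω, v x * ρ x) + f₂.toLinearMap h

/-- The densities `μ n` have bounded total variation `∫_Ω |μ n|`. -/
def BoundedVariation {N : ℕ} (Ω : Set (E N)) (μ : ℕ → E N → ℝ) : Prop :=
  ∃ M : ℝ≥0, ∀ n, eLpNorm (μ n) 1 (volume.restrict Ω) ≤ M

/-- The integral `∫_Ω g dν` against a finite signed measure. -/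
def signedIntegral {N : ℕ} (Ω : Set (E N)) (ν : SignedMeasure (E N)) (g : E N → ℝ) : ℝ :=
  (∫ x in Ω, g x ∂ν.toJordanDecomposition.posPart) -
    ∫ x in Ω, g x ∂ν.toJordanDecomposition.negPart

/-- The densities `μ n` converge weakly-* to the finite signed measure `ν`:
`∫_Ω g μ_n → ∫_Ω g dν` for all `g ∈ C(Ω̄)`. -/
def WeakStarTendsto {N : ℕ} (Ω : Set (E N)) (μ : ℕ → E N → ℝ) (ν : SignedMeasure (E N)) : Prop :=
  ∀ g : E N → ℝ, ContinuousOn g (closure Ω) →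
    Tendsto (fun n => ∫ x in Ω, g x * μ n x) atTop (𝓝 (signedIntegral Ω ν g))

end MixedPoisson

end

/-!
The difference `z = u_n - u_0` solves the problem with source `ρ = μ_n - μ_0` and homogeneous
boundary data, and only `‖ρ‖₁` is under control. Testing with a bounded function `Ψ(z)`, where
`Ψ' = (1 + s²)^(-2β)` with `2β > 1/2`, gives `∫ (1 + z²)^(-2β) |∇z|² ≤ sup |Ψ| * ‖ρ‖₁`. Hence
`w = Φ(z)`, where `Φ' = (1 + s²)^(-β)`, has a gradient bounded in `L²`, and it vanishes on `Γ₁`, so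
that the Poincaré–Sobolev inequality bounds it in `L^p` for every subcritical `p`. As `|Φ(s)|` grows
like `|s|^(1 - 2β)`, this bounds `(1 + z²)^β` in `L^m` with `m = p (1 / 2 - β) / β`, and Hölder's
inequality for `∇z = (1 + z²)^β ∇w` bounds `∇z` in `L^q`, `1/q = 1/m + 1/2`. For `β` close to `1/4`
and `p` close to the critical exponent, `q` is any prescribed number below `N / (N - 1)`.

The Poincaré–Sobolev inequality is obtained on pieces of `Ω` that are star-shaped with respect to a
ball, where a function minus its mean is dominated by the Riesz potential of its gradient, to which
Young's convolution inequality applies. Weak-* convergence reduces to bounded variation by the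
uniform boundedness principle.
-/

noncomputable section

namespace MixedPoisson

section Young

variable {G : Type*} [AddCommGroup G] [MeasurableSpace G] [MeasurableAdd₂ G] [MeasurableNeg G]
  {μ : Measure G} [μ.IsAddLeftInvariant] {f k : G → ℝ≥0∞} {a r p : ℝ}

lemma lintegral_lconvolution [SFinite μ] (hf : Measurable f) (hk : Measurable k) :
    ∫⁻ x, (f ⋆ₗ[μ] k) x ∂μ = (∫⁻ y, f y ∂μ) * ∫⁻ z, k z ∂μ := by
  simp only [lconvolution_def]
  rw [lintegral_lintegral_swap (by fun_prop), ← lintegral_mul_const _ hf]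
  refine lintegral_congr fun y => ?_
  rw [lintegral_const_mul _ (by fun_prop), lintegral_add_left_eq_self]

/- Hölder's inequality for `f k = (fᵃ kʳ) ^ (1/p) (fᵃ) ^ (1/a - 1/p) (kʳ) ^ (1/r - 1/p)`, whose
exponents sum to `1`. -/
lemma lconvolution_rpow_le [μ.IsNegInvariant] (hf : Measurable f) (hk : Measurable k)
    (ha : 1 ≤ a) (hr : 1 ≤ r) (hp : 0 < p) (har : 1 / a + 1 / r = 1 + 1 / p) (x : G) :
    (f ⋆ₗ[μ] k) x ^ p ≤ ((f · ^ a) ⋆ₗ[μ] (k · ^ r)) x *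
      ((∫⁻ y, f y ^ a ∂μ) ^ (p / a - 1) * (∫⁻ z, k z ^ r ∂μ) ^ (p / r - 1)) := by
  have ha0 : 0 < a := by linarith
  have hr0 : 0 < r := by linarith
  have hpa : 0 ≤ 1 / a - 1 / p := by linarith [(div_le_one hr0).2 hr]
  have hpr : 0 ≤ 1 / r - 1 / p := by linarith [(div_le_one ha0).2 ha]
  have hkr : ∫⁻ y, k (-y + x) ^ r ∂μ = ∫⁻ z, k z ^ r ∂μ := by
    simpa only [sub_eq_neg_add] using lintegral_sub_left_eq_self (μ := μ) (fun z => k z ^ r) x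
  have factor : ∀ y, f y * k (-y + x) = (f y ^ a * k (-y + x) ^ r) ^ (1 / p) *
      ((f y ^ a) ^ (1 / a - 1 / p) * (k (-y + x) ^ r) ^ (1 / r - 1 / p)) := by
    intro y
    rw [ENNReal.mul_rpow_of_nonneg _ _ (by positivity), mul_mul_mul_comm,
      ← ENNReal.rpow_add_of_nonneg _ _ (by positivity) hpa,
      ← ENNReal.rpow_add_of_nonneg _ _ (by positivity) hpr, ← ENNReal.rpow_mul,
      ← ENNReal.rpow_mul, add_sub_cancel, add_sub_cancel, mul_one_div_cancel ha0.ne',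
      mul_one_div_cancel hr0.ne', ENNReal.rpow_one, ENNReal.rpow_one]
  have holder : (f ⋆ₗ[μ] k) x ≤ ((f · ^ a) ⋆ₗ[μ] (k · ^ r)) x ^ (1 / p) *
      ((∫⁻ y, f y ^ a ∂μ) ^ (1 / a - 1 / p) * (∫⁻ z, k z ^ r ∂μ) ^ (1 / r - 1 / p)) := by
    have h := ENNReal.lintegral_prod_norm_pow_le (μ := μ) Finset.univ
      (f := ![fun y => f y ^ a * k (-y + x) ^ r, fun y => f y ^ a, fun y => k (-y + x) ^ r])
      (p := ![1 / p, 1 / a - 1 / p, 1 / r - 1 / p])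
      (fun i _ => by fin_cases i <;> dsimp only [Fin.reduceFinMk, Matrix.cons_val] <;> fun_prop)
      (by simp only [Fin.sum_univ_three, Matrix.cons_val]; linarith)
      (by simp only [Finset.mem_univ, Fin.forall_fin_succ]; simp_all [hp.le])
    simp only [Fin.prod_univ_three, Matrix.cons_val, mul_assoc, hkr] at h
    simpa only [lconvolution_def, factor] using h
  refine (ENNReal.rpow_le_rpow holder hp.le).trans_eq ?_
  simp only [ENNReal.mul_rpow_of_nonneg _ _ hp.le, ← ENNReal.rpow_mul]
  congr 3 <;> field_simp
  simp

lemma lintegral_lconvolution_rpow_le [SFinite μ] [μ.IsNegInvariant] (hf : Measurable f)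
    (hk : Measurable k) (ha : 1 ≤ a) (hr : 1 ≤ r) (hp : 0 < p) (har : 1 / a + 1 / r = 1 + 1 / p) :
    ∫⁻ x, (f ⋆ₗ[μ] k) x ^ p ∂μ ≤
      (∫⁻ y, f y ^ a ∂μ) ^ (p / a) * (∫⁻ z, k z ^ r ∂μ) ^ (p / r) := by
  have ha0 : 0 < a := by linarith
  have hr0 : 0 < r := by linarith
  have hpa : 0 ≤ p / a - 1 := sub_nonneg.2 <| (one_le_div ha0).2 <|
    le_of_one_div_le_one_div hp (by linarith [(div_le_one hr0).2 hr])
  have hpr : 0 ≤ p / r - 1 := sub_nonneg.2 <| (one_le_div hr0).2 <|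
    le_of_one_div_le_one_div hp (by linarith [(div_le_one ha0).2 ha])
  have hsplit : ∀ (A : ℝ≥0∞) {s : ℝ}, 0 ≤ s - 1 → A ^ s = A * A ^ (s - 1) := fun A s hs => by
    conv_lhs => rw [← add_sub_cancel 1 s, ENNReal.rpow_add_of_nonneg _ _ zero_le_one hs,
      ENNReal.rpow_one]
  calc ∫⁻ x, (f ⋆ₗ[μ] k) x ^ p ∂μ
      ≤ ∫⁻ x, ((f · ^ a) ⋆ₗ[μ] (k · ^ r)) x * ((∫⁻ y, f y ^ a ∂μ) ^ (p / a - 1) *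
          (∫⁻ z, k z ^ r ∂μ) ^ (p / r - 1)) ∂μ :=
        lintegral_mono (lconvolution_rpow_le hf hk ha hr hp har)
    _ = (∫⁻ y, f y ^ a ∂μ) * (∫⁻ z, k z ^ r ∂μ) * ((∫⁻ y, f y ^ a ∂μ) ^ (p / a - 1) *
          (∫⁻ z, k z ^ r ∂μ) ^ (p / r - 1)) := by
        rw [lintegral_mul_const _ (by fun_prop), lintegral_lconvolution (by fun_prop) (by fun_prop)]
    _ = _ := by rw [hsplit _ hpa, hsplit _ hpr, mul_mul_mul_comm]

lemma eLpNorm_lconvolution_le [SFinite μ] [μ.IsNegInvariant] (hf : Measurable f)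
    (hk : Measurable k) (ha : 1 ≤ a) (hr : 1 ≤ r) (hp : 0 < p) (har : 1 / a + 1 / r = 1 + 1 / p) :
    eLpNorm (f ⋆ₗ[μ] k) (.ofReal p) μ ≤
      eLpNorm f (.ofReal a) μ * eLpNorm k (.ofReal r) μ := by
  have ha0 : 0 < a := by linarith
  have hr0 : 0 < r := by linarith
  have hnorm : ∀ (g : G → ℝ≥0∞) {t : ℝ}, 0 < t →
      eLpNorm g (.ofReal t) μ = (∫⁻ x, g x ^ t ∂μ) ^ (1 / t) := fun g t ht => by
    simp [eLpNorm_eq_lintegral_rpow_enorm_toReal, ht, ht.le]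
  rw [hnorm _ hp, hnorm _ ha0, hnorm _ hr0]
  refine (ENNReal.rpow_le_rpow (lintegral_lconvolution_rpow_le hf hk ha hr hp har)
    (by positivity)).trans_eq ?_
  rw [ENNReal.mul_rpow_of_nonneg _ _ (by positivity), ← ENNReal.rpow_mul, ← ENNReal.rpow_mul]
  congr 2 <;> field_simp

end Young

section StarShaped

variable {F : Type*} [NormedAddCommGroup F]

/-- The truncated Riesz kernel `(d / ‖z‖) ^ s` on the ball of radius `d`. Convolution with it
bounds the oscillation of a function on a star-shaped set by its gradient. -/
def rieszKernel (d s : ℝ) : F → ℝ≥0∞ :=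
  (Metric.ball 0 d).indicator fun z => (ENNReal.ofReal d / ‖z‖ₑ) ^ s

@[fun_prop]
lemma measurable_rieszKernel [MeasurableSpace F] [BorelSpace F] (d s : ℝ) :
    Measurable (rieszKernel (F := F) d s) :=
  ((measurable_const.div measurable_enorm).pow_const s).indicator measurableSet_ball

lemma ofReal_rpow_neg_le_rieszKernel {d s t : ℝ} (hs : 0 ≤ s) (ht : t ∈ Ioo (0 : ℝ) 1) {z : F}
    (hz : ‖z‖ < t * d) : ENNReal.ofReal (t ^ (-s)) ≤ rieszKernel d s z := by
  have hd : 0 < d := pos_of_mul_pos_right ((norm_nonneg z).trans_lt hz) ht.1.le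
  have hzd : z ∈ Metric.ball (0 : F) d :=
    mem_ball_zero_iff.2 (hz.trans (mul_lt_of_lt_one_left hd ht.2))
  rw [rieszKernel, indicator_of_mem hzd, Real.rpow_neg ht.1.le, ← Real.inv_rpow ht.1.le,
    ← ENNReal.ofReal_rpow_of_pos (inv_pos.2 ht.1)]
  gcongr
  rw [ENNReal.le_div_iff_mul_le (Or.inr (by simpa using hd)) (Or.inl enorm_ne_top), ← ofReal_norm,
    ← ENNReal.ofReal_mul (inv_nonneg.2 ht.1.le)]
  exact ENNReal.ofReal_le_ofReal ((inv_mul_le_iff₀ ht.1).2 hz.le)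

variable [NormedSpace ℝ F]
  {V : Type*} [NormedAddCommGroup V] [NormedSpace ℝ V]

lemma enorm_sub_le_enorm_mul_lintegral_fderiv {φ : F → V} (hφ : ContDiff ℝ 1 φ) (x v : F)
    {T : ℝ} (hT : 0 ≤ T) :
    ‖φ (x + T • v) - φ x‖ₑ ≤ ‖v‖ₑ * ∫⁻ t in Ioo 0 T, ‖fderiv ℝ φ (x + t • v)‖ₑ := by
  have hline : ContDiff ℝ 1 fun t : ℝ => φ (x + t • v) := by fun_prop
  have hderiv : ∀ t : ℝ, deriv (fun t : ℝ => φ (x + t • v)) t = fderiv ℝ φ (x + t • v) v := by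
    intro t
    refine HasDerivAt.deriv ((hφ.differentiable one_ne_zero _).hasFDerivAt.comp_hasDerivAt t ?_)
    simpa using ((hasDerivAt_id t).smul_const v).const_add x
  calc ‖φ (x + T • v) - φ x‖ₑ ≤ ∫⁻ t in Icc 0 T, ‖fderiv ℝ φ (x + t • v) v‖ₑ := by
        simpa [hderiv] using enorm_sub_le_lintegral_deriv_of_contDiffOn_Icc hline.contDiffOn hT
    _ ≤ ∫⁻ t in Icc 0 T, ‖v‖ₑ * ‖fderiv ℝ φ (x + t • v)‖ₑ :=
        lintegral_mono fun t => (ContinuousLinearMap.le_opENorm _ _).trans_eq (mul_comm _ _)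
    _ = ‖v‖ₑ * ∫⁻ t in Ioo 0 T, ‖fderiv ℝ φ (x + t • v)‖ₑ := by
        rw [lintegral_const_mul' _ _ enorm_ne_top, restrict_Ioo_eq_restrict_Icc]

variable [FiniteDimensional ℝ F] [MeasurableSpace F] [BorelSpace F] {μ : Measure F}
  [μ.IsAddHaarMeasure]

lemma lintegral_comp_homothety {f : F → ℝ≥0∞} (hf : Measurable f) (x : F) {t : ℝ} (ht : 0 < t) :
    ∫⁻ y, f (x + t • (y - x)) ∂μ =
      ENNReal.ofReal (t ^ Module.finrank ℝ F)⁻¹ * ∫⁻ y, f y ∂μ := by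
  rw [lintegral_sub_right_eq_self (fun y => f (x + t • y)) x,
    ← lintegral_map (f := fun y => f (x + y)) (by fun_prop) (measurable_const_smul t),
    Measure.map_addHaar_smul _ ht.ne', lintegral_smul_measure, lintegral_add_left_eq_self,
    abs_of_pos (by positivity), smul_eq_mul]

lemma eLpNorm_rieszKernel_lt_top [Nontrivial F] (d : ℝ) {s r : ℝ} (hr : 0 < r)
    (hsr : s * r < Module.finrank ℝ F) :
    eLpNorm (rieszKernel (F := F) d s) (.ofReal r) μ < ⊤ := by
  have hint : IntegrableOn (fun z : F => d ^ (s * r) * ‖z‖ ^ (-(s * r))) (Metric.ball 0 d) μ := by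
    refine integrableOn_ball_of_norm_le_rpow Module.finrank_pos (C := |d ^ (s * r)|) hsr ?_
      (by fun_prop : Measurable _).aestronglyMeasurable
    exact Eventually.of_forall fun z => by
      rw [norm_mul, Real.norm_eq_abs, Real.norm_of_nonneg (by positivity)]
  rw [eLpNorm_lt_top_iff_lintegral_rpow_enorm_lt_top (by simpa) (by simp)]
  simp only [enorm_eq_self, ENNReal.toReal_ofReal hr.le]
  refine lt_of_le_of_lt ?_ hint.2
  rw [← lintegral_indicator measurableSet_ball]
  refine lintegral_mono_ae ?_
  filter_upwards [Measure.ae_ne μ (0 : F)] with z hz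
  by_cases hzd : z ∈ Metric.ball (0 : F) d
  · have hd : 0 < d := dist_nonneg.trans_lt hzd
    have hz' : 0 < ‖z‖ := norm_pos_iff.2 hz
    rw [rieszKernel, indicator_of_mem hzd, indicator_of_mem hzd, ← ENNReal.rpow_mul, ← ofReal_norm,
      ← ENNReal.ofReal_div_of_pos hz', ENNReal.ofReal_rpow_of_pos (by positivity),
      Real.enorm_of_nonneg (by positivity), Real.div_rpow hd.le hz'.le, Real.rpow_neg hz'.le,
      div_eq_mul_inv]
  · simp [rieszKernel, hzd, hr]

/- The homothety of centre `x` and ratio `t` has Jacobian `t ^ n`, and the excess `t ^ (-s)` of the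
kernel makes the remaining integral in `t` converge for `s > n - 1`. -/
lemma lintegral_lintegral_homothety_le {f : F → ℝ≥0∞} (hf : Measurable f) (x : F) (d : ℝ) {s : ℝ}
    (hs : 0 ≤ s) :
    ∫⁻ y in Metric.ball x d, ∫⁻ t in Ioo (0 : ℝ) 1, f (x + t • (y - x)) ∂volume ∂μ ≤
      (∫⁻ t in Ioo (0 : ℝ) 1, ENNReal.ofReal (t ^ (s - Module.finrank ℝ F))) *
        (f ⋆ₗ[μ] rieszKernel d s) x := by
  rw [lintegral_lintegral_swap (by fun_prop), ← lintegral_mul_const _ (by fun_prop)]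
  refine setLIntegral_mono' measurableSet_Ioo fun t ht => ?_
  have hball : (Metric.ball x d).indicator (fun y => f (x + t • (y - x))) =
      fun y => (Metric.ball x (t * d)).indicator f (x + t • (y - x)) := by
    ext y
    have hmem : x + t • (y - x) ∈ Metric.ball x (t * d) ↔ y ∈ Metric.ball x d := by
      rw [Metric.mem_ball, Metric.mem_ball, dist_eq_norm, dist_eq_norm, add_sub_cancel_left,
        norm_smul, Real.norm_of_nonneg ht.1.le, mul_lt_mul_iff_right₀ ht.1]
    by_cases hy : y ∈ Metric.ball x d
    · rw [indicator_of_mem hy, indicator_of_mem (hmem.2 hy)]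
    · rw [indicator_of_notMem hy, indicator_of_notMem (mt hmem.1 hy)]
  calc ∫⁻ y in Metric.ball x d, f (x + t • (y - x)) ∂μ
      = ENNReal.ofReal (t ^ Module.finrank ℝ F)⁻¹ * ∫⁻ y in Metric.ball x (t * d), f y ∂μ := by
        rw [← lintegral_indicator measurableSet_ball, hball,
          lintegral_comp_homothety (hf.indicator measurableSet_ball) x ht.1,
          lintegral_indicator measurableSet_ball]
    _ = ENNReal.ofReal (t ^ (s - Module.finrank ℝ F)) *
          ∫⁻ y in Metric.ball x (t * d), ENNReal.ofReal (t ^ (-s)) * f y ∂μ := by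
        rw [lintegral_const_mul _ hf, ← mul_assoc, ← ENNReal.ofReal_mul (by positivity [ht.1]),
          ← Real.rpow_add ht.1, ← Real.rpow_natCast, ← Real.rpow_neg ht.1.le]
        ring_nf
    _ ≤ ENNReal.ofReal (t ^ (s - Module.finrank ℝ F)) *
          ∫⁻ y in Metric.ball x (t * d), f y * rieszKernel d s (-y + x) ∂μ := by
        gcongr 1
        refine setLIntegral_mono (by fun_prop) fun y hy => ?_
        rw [mul_comm]
        gcongr
        refine ofReal_rpow_neg_le_rieszKernel hs ht ?_
        rwa [← sub_eq_neg_add, ← dist_eq_norm']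
    _ ≤ _ := by gcongr 1; exact setLIntegral_le_lintegral _ _

lemma lintegral_Ioo_rpow_lt_top {a : ℝ} (ha : -1 < a) :
    ∫⁻ t in Ioo (0 : ℝ) 1, ENNReal.ofReal (t ^ a) < ⊤ := by
  refine lt_of_le_of_lt (setLIntegral_mono' measurableSet_Ioo fun t ht => ?_)
    ((intervalIntegral.integrableOn_Ioo_rpow_iff zero_lt_one).2 ha).2
  rw [Real.enorm_of_nonneg (Real.rpow_nonneg ht.1.le _)]

lemma enorm_sub_average_le_laverage {α : Type*} [MeasurableSpace α] {ν : Measure α}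
    [IsFiniteMeasure ν] [NeZero ν] [CompleteSpace V] {φ : α → V} (hφ : Integrable φ ν) (v : V) :
    ‖v - ⨍ y, φ y ∂ν‖ₑ ≤ ⨍⁻ y, ‖v - φ y‖ₑ ∂ν := by
  have hsub : v - ⨍ y, φ y ∂ν = ∫ y, (v - φ y) ∂(ν univ)⁻¹ • ν := by
    rw [integral_sub (integrable_const _) hφ.to_average, integral_const, probReal_univ, one_smul]
    rfl
  exact hsub ▸ enorm_integral_le_lintegral_enorm _

variable [CompleteSpace V] {D : Set F} {b : F} {ρ d : ℝ}

lemma enorm_sub_average_ball_le_lconvolution_rieszKernel (hDm : MeasurableSet D) (hρ : 0 < ρ)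
    (hD : ∀ y ∈ Metric.ball b ρ, StarConvex ℝ y D) {x : F} (hx : x ∈ D) (hDd : D ⊆ Metric.ball x d)
    {s : ℝ} (hs : 0 ≤ s) {φ : F → V} (hφ : ContDiff ℝ 1 φ) :
    ‖φ x - ⨍ y in Metric.ball b ρ, φ y ∂μ‖ₑ ≤
      (μ (Metric.ball b ρ))⁻¹ * (ENNReal.ofReal d *
        ((∫⁻ t in Ioo (0 : ℝ) 1, ENNReal.ofReal (t ^ (s - Module.finrank ℝ F))) *
          ((D.indicator fun y => ‖fderiv ℝ φ y‖ₑ) ⋆ₗ[μ] rieszKernel d s) x)) := by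
  set f : F → ℝ≥0∞ := D.indicator fun y => ‖fderiv ℝ φ y‖ₑ with hf
  have hfm : Measurable f := (hφ.continuous_fderiv one_ne_zero).enorm.measurable.indicator hDm
  have hBD : Metric.ball b ρ ⊆ D := fun y hy => (hD y hy).mem ⟨x, hx⟩
  have : IsFiniteMeasure (μ.restrict (Metric.ball b ρ)) := ⟨by simpa using measure_ball_lt_top⟩
  have : NeZero (μ.restrict (Metric.ball b ρ)) :=
    ⟨by simpa using (Metric.measure_ball_pos μ b hρ).ne'⟩
  have hint : IntegrableOn φ (Metric.ball b ρ) μ :=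
    (hφ.continuous.continuousOn.integrableOn_compact (isCompact_closedBall b ρ)).mono_set
      Metric.ball_subset_closedBall
  have hseg : ∀ y ∈ Metric.ball b ρ, ‖φ x - φ y‖ₑ ≤
      ENNReal.ofReal d * ∫⁻ t in Ioo (0 : ℝ) 1, f (x + t • (y - x)) := by
    intro y hy
    have h := enorm_sub_le_enorm_mul_lintegral_fderiv hφ x (y - x) zero_le_one
    rw [one_smul, add_sub_cancel, enorm_sub_rev] at h
    refine h.trans (mul_le_mul' ?_ (setLIntegral_mono' measurableSet_Ioo fun t ht => ?_))
    · rw [← ofReal_norm, ← dist_eq_norm]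
      exact ENNReal.ofReal_le_ofReal (Metric.mem_ball.1 (hDd (hBD hy))).le
    · rw [hf, indicator_of_mem]
      convert! (hD y hy) hx ht.1.le (sub_nonneg.2 ht.2.le) (add_sub_cancel t 1) using 1
      module
  calc ‖φ x - ⨍ y in Metric.ball b ρ, φ y ∂μ‖ₑ
      ≤ (μ (Metric.ball b ρ))⁻¹ * ∫⁻ y in Metric.ball b ρ, ‖φ x - φ y‖ₑ ∂μ := by
        refine (enorm_sub_average_le_laverage hint _).trans_eq ?_
        rw [laverage_eq, Measure.restrict_apply_univ, ENNReal.div_eq_inv_mul]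
    _ ≤ (μ (Metric.ball b ρ))⁻¹ * ∫⁻ y in Metric.ball x d,
          ENNReal.ofReal d * ∫⁻ t in Ioo (0 : ℝ) 1, f (x + t • (y - x)) ∂volume ∂μ := by
        gcongr 1
        exact (setLIntegral_mono' measurableSet_ball hseg).trans
          (lintegral_mono_set (hBD.trans hDd))
    _ ≤ _ := by
        rw [lintegral_const_mul' _ _ ENNReal.ofReal_ne_top]
        gcongr
        exact lintegral_lintegral_homothety_le hfm x d hs

lemma exists_riesz_exponents {n a p : ℝ} (hn : 1 ≤ n) (ha : 1 ≤ a) (hap : a ≤ p)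
    (hpa : 1 / a - 1 / n < 1 / p) :
    ∃ r s : ℝ, 1 ≤ r ∧ 1 / a + 1 / r = 1 + 1 / p ∧ n - 1 < s ∧ s * r < n := by
  have hp : 0 < 1 / p := one_div_pos.2 (by linarith)
  have ha' : 1 / a ≤ 1 := (div_le_one (by linarith)).2 ha
  obtain ⟨r, hr⟩ : ∃ r : ℝ, 1 / r = 1 + 1 / p - 1 / a := ⟨_, one_div_one_div _⟩
  have hr0 : 0 < r := one_div_pos.1 (by linarith)
  obtain ⟨s, hns, hsr⟩ : ∃ s : ℝ, n - 1 < s ∧ s < n / r := by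
    refine exists_between ?_
    have h := mul_lt_mul_of_pos_left hpa (by linarith : 0 < n)
    rw [mul_sub, mul_one_div_cancel (by linarith)] at h
    rw [div_eq_mul_one_div, hr]
    linarith
  refine ⟨r, s, (one_div_le_one_div hr0 one_pos).1 ?_, by linarith, hns, (lt_div_iff₀ hr0).1 hsr⟩
  linarith [one_div_le_one_div_of_le (by linarith) hap]

theorem exists_eLpNorm_sub_average_ball_le [Nontrivial F] (hDm : MeasurableSet D)
    (hDb : Bornology.IsBounded D) (hρ : 0 < ρ) (hD : ∀ y ∈ Metric.ball b ρ, StarConvex ℝ y D)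
    {a p : ℝ} (ha : 1 ≤ a) (hap : a ≤ p) (hpa : 1 / a - 1 / Module.finrank ℝ F < 1 / p) :
    ∃ C : ℝ≥0, ∀ φ : F → V, ContDiff ℝ 1 φ →
      eLpNorm (fun x => φ x - ⨍ y in Metric.ball b ρ, φ y ∂μ) (.ofReal p) (μ.restrict D) ≤
        C * eLpNorm (fderiv ℝ φ) (.ofReal a) (μ.restrict D) := by
  have hn : (1 : ℝ) ≤ Module.finrank ℝ F := by exact_mod_cast Module.finrank_pos (R := ℝ) (M := F)
  obtain ⟨r, s, hr, har, hns, hsr⟩ := exists_riesz_exponents hn ha hap hpa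
  set d := Metric.diam D + 1
  have hD_ball : ∀ x ∈ D, D ⊆ Metric.ball x d := fun x hx y hy =>
    (Metric.dist_le_diam_of_mem hDb hy hx).trans_lt (lt_add_one _)
  have hκ := ENNReal.coe_toNNReal (eLpNorm_rieszKernel_lt_top (μ := μ) d (by linarith) hsr).ne
  have hτ := ENNReal.coe_toNNReal
    (lintegral_Ioo_rpow_lt_top (a := s - Module.finrank ℝ F) (by linarith)).ne
  have hβ := ENNReal.coe_toNNReal (ENNReal.inv_ne_top.2 (Metric.measure_ball_pos μ b hρ).ne')
  set κ := (eLpNorm (rieszKernel d s) (.ofReal r) μ).toNNReal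
  set τ := (∫⁻ t : ℝ in Ioo 0 1, ENNReal.ofReal (t ^ (s - Module.finrank ℝ F))).toNNReal
  set β := (μ (Metric.ball b ρ))⁻¹.toNNReal
  refine ⟨β * (d.toNNReal * τ) * κ, fun φ hφ => ?_⟩
  have hfm : Measurable (D.indicator fun y => ‖fderiv ℝ φ y‖ₑ) :=
    (hφ.continuous_fderiv one_ne_zero).enorm.measurable.indicator hDm
  calc _ ≤ (β * (d.toNNReal * τ)) • eLpNorm ((D.indicator fun y => ‖fderiv ℝ φ y‖ₑ) ⋆ₗ[μ]
          rieszKernel d s) (.ofReal p) (μ.restrict D) := by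
        refine eLpNorm_le_nnreal_smul_eLpNorm_of_ae_le_mul' (ae_restrict_of_forall_mem hDm
          fun x hx => ?_) _
        rw [enorm_eq_self, ENNReal.coe_mul, ENNReal.coe_mul, hβ, hτ, mul_assoc, mul_assoc]
        exact enorm_sub_average_ball_le_lconvolution_rieszKernel hDm hρ hD hx (hD_ball x hx)
          (by linarith) hφ
    _ ≤ (β * (d.toNNReal * τ)) • (eLpNorm (D.indicator fun y => ‖fderiv ℝ φ y‖ₑ) (.ofReal a) μ *
          κ) := by
        rw [hκ]
        gcongr
        exact (eLpNorm_restrict_le _ _ _ _).trans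
          (eLpNorm_lconvolution_le hfm (by fun_prop) ha hr (by linarith) har)
    _ = _ := by
        rw [eLpNorm_indicator_eq_eLpNorm_restrict hDm, eLpNorm_enorm, ENNReal.smul_def,
          smul_eq_mul, ENNReal.coe_mul _ κ, mul_assoc, mul_comm (κ : ℝ≥0∞)]

end StarShaped

section LipschitzGraph

lemma restrict_hausdorffMeasure_le_smul_map {X Y : Type*} [MetricSpace X] [MeasurableSpace X]
    [BorelSpace X] [MetricSpace Y] [MeasurableSpace Y] [BorelSpace Y] {f : X → Y} {K : ℝ≥0}
    (hf : LipschitzWith K f) {d : ℝ} (hd : 0 ≤ d) {B : Set X} {G : Set Y} (hG : G ⊆ f '' B) :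
    (Measure.hausdorffMeasure d).restrict G ≤
      ((K : ℝ≥0∞) ^ d) • Measure.map f ((Measure.hausdorffMeasure d).restrict B) := by
  refine Measure.le_iff.2 fun S hS => ?_
  have hfm := hf.continuous.measurable
  rw [Measure.restrict_apply hS, Measure.smul_apply, Measure.map_apply hfm hS,
    Measure.restrict_apply (hfm hS), smul_eq_mul]
  refine le_trans (measure_mono ?_) (hf.hausdorffMeasure_image_le hd _)
  rintro _ ⟨hyS, hyG⟩
  obtain ⟨x, hxB, rfl⟩ := hG hyG
  exact ⟨x, ⟨hyS, hxB⟩, rfl⟩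

variable {V W Z : Type*} [NormedAddCommGroup V] [NormedSpace ℝ V]
  [NormedAddCommGroup W] [NormedSpace ℝ W] [NormedAddCommGroup Z] [NormedSpace ℝ Z]

lemma starConvex_epigraph {γ : W → ℝ} {L : ℝ≥0} (hγ : LipschitzWith L γ) {B : Set W}
    (hB : Convex ℝ B) {y : W × ℝ} (hy : y.1 ∈ B) {d : ℝ} (hd : ∀ x ∈ B, dist y.1 x ≤ d)
    (hyB : ∀ x ∈ B, γ x + L * d < y.2) : StarConvex ℝ y {w | w.1 ∈ B ∧ γ w.1 < w.2} := by
  rintro w ⟨hwB, hw⟩ a b ha hb hab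
  have hpB : a • y.1 + b • w.1 ∈ B := hB hy hwB ha hb hab
  have hdist : dist (a • y.1 + b • w.1) w.1 = a * dist y.1 w.1 := by
    rw [dist_eq_norm, dist_eq_norm, ← norm_smul_of_nonneg ha, eq_sub_of_add_eq' hab]
    congr 1
    module
  have hLd : 0 ≤ L * d := mul_nonneg L.coe_nonneg (dist_nonneg.trans (hd _ hy))
  have hLip : γ (a • y.1 + b • w.1) ≤ γ w.1 + a * (L * d) := by
    have h := hγ.dist_le_mul (a • y.1 + b • w.1) w.1
    rw [hdist, mul_left_comm, Real.dist_eq] at h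
    have hd' : a * (L * dist y.1 w.1) ≤ a * (L * d) := by
      gcongr
      exact hd _ hwB
    linarith [(le_abs_self _).trans h]
  refine ⟨hpB, ?_⟩
  have hay : a * (γ (a • y.1 + b • w.1) + L * d) ≤ a * y.2 :=
    mul_le_mul_of_nonneg_left (hyB _ hpB).le ha
  change γ (a • y.1 + b • w.1) < a * y.2 + b * w.2
  rcases hb.eq_or_lt with rfl | hb
  · obtain rfl : a = 1 := by simpa using hab
    linarith [hyB _ hpB]
  · obtain rfl : a = 1 - b := by linarith
    nlinarith [mul_lt_mul_of_pos_left hw hb, mul_le_mul_of_nonneg_left hLip hb.le,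
      mul_nonneg (mul_nonneg ha hLd) ha]

lemma enorm_le_inv_mul_lintegral_add_lintegral_fderiv {φ : V → Z} (hφ : ContDiff ℝ 1 φ) (x v : V)
    {r : ℝ} (hr : 0 < r) :
    ‖φ x‖ₑ ≤ (ENNReal.ofReal r)⁻¹ * (∫⁻ t in Ioo 0 r, ‖φ (x + t • v)‖ₑ) +
      ‖v‖ₑ * ∫⁻ t in Ioo 0 r, ‖fderiv ℝ φ (x + t • v)‖ₑ := by
  have hr0 : ENNReal.ofReal r ≠ 0 := by simpa using hr
  set I := ‖v‖ₑ * ∫⁻ t in Ioo 0 r, ‖fderiv ℝ φ (x + t • v)‖ₑ with hI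
  have hpt : ∀ t ∈ Ioo 0 r, ‖φ x‖ₑ ≤ ‖φ (x + t • v)‖ₑ + I := fun t ht =>
    calc ‖φ x‖ₑ = ‖φ (x + t • v) - (φ (x + t • v) - φ x)‖ₑ := by rw [sub_sub_cancel]
      _ ≤ ‖φ (x + t • v)‖ₑ + ‖φ (x + t • v) - φ x‖ₑ := enorm_sub_le
      _ ≤ ‖φ (x + t • v)‖ₑ + I := by
        grw [enorm_sub_le_enorm_mul_lintegral_fderiv hφ x v ht.1.le, hI, ht.2]
  have hint : ENNReal.ofReal r * ‖φ x‖ₑ ≤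
      (∫⁻ t in Ioo 0 r, ‖φ (x + t • v)‖ₑ) + ENNReal.ofReal r * I := by
    have := setLIntegral_mono' (μ := volume) measurableSet_Ioo hpt
    rw [lintegral_add_right _ measurable_const] at this
    simpa [mul_comm] using this
  calc ‖φ x‖ₑ = (ENNReal.ofReal r)⁻¹ * (ENNReal.ofReal r * ‖φ x‖ₑ) := by
        rw [ENNReal.inv_mul_cancel_left' (by simp [hr0]) (by simp)]
    _ ≤ _ := by
        grw [hint]
        rw [mul_add, ENNReal.inv_mul_cancel_left' (by simp [hr0]) (by simp)]

variable [FiniteDimensional ℝ V] [MeasurableSpace V] [BorelSpace V]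
  [FiniteDimensional ℝ W] [MeasurableSpace W] [BorelSpace W]
  (μ : Measure V) [μ.IsAddHaarMeasure] (ν : Measure W) [ν.IsAddHaarMeasure]
  (e : V ≃L[ℝ] W × ℝ)

lemma exists_setLIntegral_aboveGraph_le :
    ∃ C : ℝ≥0, ∀ (γ : W → ℝ) (B : Set W) (D : Set V) (r : ℝ), MeasurableSet B → MeasurableSet D →
      (∀ x ∈ B, ∀ t ∈ Ioo 0 r, e.symm (x, γ x + t) ∈ D) → ∀ f : V → ℝ≥0∞, Measurable f →
        ∫⁻ x in B, (∫⁻ t in Ioo 0 r, f (e.symm (x, γ x + t))) ∂ν ≤ C * ∫⁻ y in D, f y ∂μ := by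
  have he : Measurable e.symm := e.symm.continuous.measurable
  have : ((ν.prod volume).map e.symm).IsAddHaarMeasure :=
    e.symm.isAddHaarMeasure_map (ν.prod (volume : Measure ℝ))
  refine ⟨((ν.prod volume).map e.symm).addHaarScalarFactor μ, fun γ B D r hB hD hsub f hf => ?_⟩
  have hfD : Measurable (D.indicator f) := hf.indicator hD
  calc ∫⁻ x in B, (∫⁻ t in Ioo 0 r, f (e.symm (x, γ x + t))) ∂ν
      ≤ ∫⁻ x in B, (∫⁻ t, D.indicator f (e.symm (x, γ x + t))) ∂ν := by
        refine setLIntegral_mono' hB fun x hx => (setLIntegral_mono' measurableSet_Ioo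
          fun t ht => ?_).trans (setLIntegral_le_lintegral (Ioo 0 r) _)
        rw [indicator_of_mem (hsub x hx t ht)]
    _ ≤ ∫⁻ x, (∫⁻ t, D.indicator f (e.symm (x, γ x + t))) ∂ν := setLIntegral_le_lintegral _ _
    _ = ∫⁻ x, (∫⁻ t, D.indicator f (e.symm (x, t))) ∂ν := lintegral_congr fun x =>
        lintegral_add_left_eq_self (fun t => D.indicator f (e.symm (x, t))) (γ x)
    _ = ∫⁻ y, D.indicator f y ∂((ν.prod volume).map e.symm) := by
        rw [lintegral_map hfD he]
        exact (lintegral_prod (fun w => D.indicator f (e.symm w)) (hfD.comp he).aemeasurable).symm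
    _ = _ := by
        conv_lhs => rw [Measure.isAddLeftInvariant_eq_smul ((ν.prod volume).map e.symm) μ]
        rw [lintegral_indicator hD, Measure.restrict_smul]
        exact lintegral_smul_measure _ _

lemma exists_eLpNorm_one_graph_le {r : ℝ} (hr : 0 < r) :
    ∃ C : ℝ≥0, ∀ (γ : W → ℝ) (B : Set W) (D : Set V), Continuous γ → MeasurableSet B →
      MeasurableSet D → (∀ x ∈ B, ∀ t ∈ Ioo 0 r, e.symm (x, γ x + t) ∈ D) →
      ∀ φ : V → Z, ContDiff ℝ 1 φ →
        ∫⁻ x in B, ‖φ (e.symm (x, γ x))‖ₑ ∂ν ≤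
          C * (eLpNorm φ 1 (μ.restrict D) + eLpNorm (fderiv ℝ φ) 1 (μ.restrict D)) := by
  obtain ⟨C, hC⟩ := exists_setLIntegral_aboveGraph_le μ ν e
  set v : V := e.symm (0, 1)
  have hv : ∀ x s t, e.symm (x, s + t) = e.symm (x, s) + t • v := fun x s t => by
    simp [v, ← map_smul, ← map_add]
  refine ⟨(r.toNNReal⁻¹ + ‖v‖₊) * C, fun γ B D hγ hB hD hsub φ hφ => ?_⟩
  have hφm : Measurable fun y => ‖φ y‖ₑ := hφ.continuous.enorm.measurable
  have hφm' : Measurable fun y => ‖fderiv ℝ φ y‖ₑ :=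
    (hφ.continuous_fderiv one_ne_zero).enorm.measurable
  have hvert : ∀ f : V → ℝ≥0∞, Measurable f →
      Measurable fun x => ∫⁻ t in Ioo 0 r, f (e.symm (x, γ x + t)) := fun f hf =>
    (hf.comp (by fun_prop : Measurable fun w : W × ℝ =>
      e.symm (w.1, γ w.1 + w.2))).lintegral_prod_right'
  calc ∫⁻ x in B, ‖φ (e.symm (x, γ x))‖ₑ ∂ν
      ≤ ∫⁻ x in B, ((ENNReal.ofReal r)⁻¹ * (∫⁻ t in Ioo 0 r, ‖φ (e.symm (x, γ x + t))‖ₑ) +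
          ‖v‖ₑ * ∫⁻ t in Ioo 0 r, ‖fderiv ℝ φ (e.symm (x, γ x + t))‖ₑ) ∂ν := by
        simp only [hv]
        exact lintegral_mono fun x => enorm_le_inv_mul_lintegral_add_lintegral_fderiv hφ _ v hr
    _ = (ENNReal.ofReal r)⁻¹ *
            (∫⁻ x in B, (∫⁻ t in Ioo 0 r, ‖φ (e.symm (x, γ x + t))‖ₑ) ∂ν) +
          ‖v‖ₑ * ∫⁻ x in B, (∫⁻ t in Ioo 0 r, ‖fderiv ℝ φ (e.symm (x, γ x + t))‖ₑ) ∂ν := by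
        rw [lintegral_add_left ((hvert _ hφm).const_mul _), lintegral_const_mul _ (hvert _ hφm),
          lintegral_const_mul _ (hvert _ hφm')]
    _ ≤ (ENNReal.ofReal r)⁻¹ * (C * ∫⁻ y in D, ‖φ y‖ₑ ∂μ) +
          ‖v‖ₑ * (C * ∫⁻ y in D, ‖fderiv ℝ φ y‖ₑ ∂μ) := by
        gcongr
        · exact hC γ B D r hB hD hsub _ hφm
        · exact hC γ B D r hB hD hsub _ hφm'
    _ ≤ _ := by
        rw [eLpNorm_one_eq_lintegral_enorm, eLpNorm_one_eq_lintegral_enorm, ENNReal.coe_mul,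
          ENNReal.coe_add, ENNReal.coe_inv (by simpa using hr), mul_add, ← mul_assoc, ← mul_assoc]
        gcongr
        · exact le_self_add
        · exact le_add_self

end LipschitzGraph

/-- The functional `P` is at most a constant multiple of `Q` on `C¹` functions. -/
def DominatedOnC1 {F : Type*} [NormedAddCommGroup F] [NormedSpace ℝ F]
    (P Q : (F → ℝ) → ℝ≥0∞) : Prop :=
  ∃ C : ℝ≥0, ∀ φ, ContDiff ℝ 1 φ → P φ ≤ C * Q φ

section Chart

/-- Localization of a domain `Ω` near a point of its closure: `K` is open, `K ∩ Ω` is star-shaped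
with respect to every point of a ball, and a trace inequality holds on `K ∩ ∂Ω`. -/
structure IsTraceChart {N : ℕ} (Ω K : Set (E N)) (b : E N) (ρ : ℝ) : Prop where
  isOpen : IsOpen K
  radius_pos : 0 < ρ
  starConvex : ∀ y ∈ Metric.ball b ρ, StarConvex ℝ y (K ∩ Ω)
  trace : DominatedOnC1 (fun φ => eLpNorm φ 1 ((surf Ω).restrict K)) fun φ =>
    eLpNorm φ 1 (volume.restrict (K ∩ Ω)) + eLpNorm (fderiv ℝ φ) 1 (volume.restrict (K ∩ Ω))

variable {N : ℕ} {Ω : Set (E N)}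

lemma exists_isTraceChart_of_mem (hΩ : IsOpen Ω) {P : E N} (hP : P ∈ Ω) :
    ∃ K b ρ, P ∈ K ∧ IsTraceChart Ω K b ρ := by
  obtain ⟨r, hr, hsub⟩ := Metric.isOpen_iff.1 hΩ P hP
  have hsurf : (surf Ω).restrict (Metric.ball P r) = 0 := by
    have hdisj : Metric.ball P r ∩ frontier Ω = ∅ := disjoint_iff_inter_eq_empty.1 <|
      (disjoint_frontier_iff_isOpen.2 hΩ).symm.mono_left hsub
    rw [surf, Measure.restrict_restrict measurableSet_ball, hdisj, Measure.restrict_empty]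
  refine ⟨Metric.ball P r, P, r, Metric.mem_ball_self hr, Metric.isOpen_ball, hr, fun y hy => ?_,
    0, fun φ _ => by simp [hsurf]⟩
  rw [inter_eq_left.2 hsub]
  exact (convex_ball P r).starConvex hy

lemma inter_frontier_subset_eq {X : Type*} [TopologicalSpace X] {U S : Set X} {f g : X → ℝ}
    (hU : IsOpen U) (hf : Continuous f) (hg : Continuous g) (hS : U ∩ S = U ∩ {x | f x < g x}) :
    U ∩ frontier S ⊆ {x | f x = g x} := by
  have hSU : frontier S ∩ U = frontier {x | f x < g x} ∩ U := by
    rw [← frontier_inter_open_inter hU, inter_comm S, hS, inter_comm U,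
      frontier_inter_open_inter hU]
  rw [inter_comm, hSU]
  exact inter_subset_left.trans (frontier_lt_subset_eq hf hg)

section Box

variable {X : Type*} [PseudoMetricSpace X] {γ : X → ℝ} {L : ℝ≥0} {r : ℝ}

/-- A neighbourhood of `(x, γ x)` in which the region above the graph of an `L`-Lipschitz function
`γ` is star-shaped with respect to all points near `(x, γ x + (3L + 1) r)`: the graph over
`ball x r` stays below height `γ x + L r`, and the slope over distances at most `2 r` costs
another `2 L r`. -/
def graphBox (γ : X → ℝ) (L : ℝ≥0) (x : X) (r : ℝ) : Set (X × ℝ) :=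
  Metric.ball x r ×ˢ Metric.ball (γ x) ((3 * L + 2) * r)

lemma exists_graphBox_subset (L : ℝ≥0) {x : X} {T : Set (X × ℝ)} (hT : T ∈ 𝓝 (x, γ x)) :
    ∃ r > 0, graphBox γ L x r ⊆ T := by
  obtain ⟨ε, hε, hεT⟩ := Metric.mem_nhds_iff.1 hT
  refine ⟨ε / (3 * L + 2), by positivity, Subset.trans ?_ hεT⟩
  rw [graphBox, ← ball_prod_same, mul_div_cancel₀ _ (by positivity)]
  refine prod_mono (Metric.ball_subset_ball ?_) subset_rfl
  exact div_le_self hε.le (by linarith [L.coe_nonneg])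

lemma abs_sub_le_of_mem_ball (hγ : LipschitzWith L γ) {x y : X} (hy : y ∈ Metric.ball x r) :
    |γ y - γ x| ≤ L * r := by
  rw [← Real.dist_eq]
  exact (hγ.dist_le_mul y x).trans (by gcongr; exact (Metric.mem_ball.1 hy).le)

lemma mem_graphBox_of_mem_Ioo (hγ : LipschitzWith L γ) {x y : X} (hy : y ∈ Metric.ball x r) {t : ℝ}
    (ht : t ∈ Ioo 0 r) : (y, γ y + t) ∈ graphBox γ L x r := by
  refine ⟨hy, ?_⟩
  have hγy := abs_le.1 (abs_sub_le_of_mem_ball hγ hy)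
  have hLr : 0 ≤ L * r := mul_nonneg L.coe_nonneg (ht.1.trans ht.2).le
  rw [Metric.mem_ball, Real.dist_eq, abs_lt]
  constructor <;> linarith only [ht.1, ht.2, hγy.1, hγy.2, hLr]

lemma eventually_starConvex_graphBox_inter_epigraph {W : Type*} [NormedAddCommGroup W]
    [NormedSpace ℝ W] {γ : W → ℝ} (hγ : LipschitzWith L γ) (x : W) (hr : 0 < r) :
    ∀ᶠ y in 𝓝 (x, γ x + (3 * L + 1) * r),
      StarConvex ℝ y (graphBox γ L x r ∩ {w | γ w.1 < w.2}) := by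
  have hLr : 0 ≤ L * r := by positivity
  have hfst : ∀ᶠ y : W × ℝ in 𝓝 (x, γ x + (3 * L + 1) * r), y.1 ∈ Metric.ball x r :=
    continuousAt_fst.eventually_mem (Metric.ball_mem_nhds x hr)
  have hsnd : ∀ᶠ y : W × ℝ in 𝓝 (x, γ x + (3 * L + 1) * r),
      y.2 ∈ Ioo (γ x + 3 * L * r) (γ x + (3 * L + 2) * r) :=
    continuousAt_snd.eventually_mem (Ioo_mem_nhds (by linarith) (by linarith))
  filter_upwards [hfst, hsnd] with y hy₁ hy₂
  have hepi : StarConvex ℝ y {w | w.1 ∈ Metric.ball x r ∧ γ w.1 < w.2} := by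
    refine starConvex_epigraph hγ (convex_ball x r) hy₁ (d := 2 * r) (fun w hw => ?_) fun w hw => ?_
    · linarith [dist_triangle_right y.1 w x, Metric.mem_ball.1 hy₁, Metric.mem_ball.1 hw]
    · linarith [(abs_le.1 (abs_sub_le_of_mem_ball hγ hw)).2, hy₂.1]
  have hstrip : StarConvex ℝ y {w : W × ℝ | w.2 ∈ Metric.ball (γ x) ((3 * L + 2) * r)} := by
    refine ((convex_ball _ _).linear_preimage (LinearMap.snd ℝ W ℝ)).starConvex ?_
    rw [mem_preimage, LinearMap.snd_apply, Metric.mem_ball, Real.dist_eq, abs_lt]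
    constructor <;> linarith only [hy₂.1, hy₂.2, hLr, hr]
  convert hepi.inter hstrip using 1
  ext w
  exact and_right_comm

end Box

lemma trace_of_subset_graph (hN : 1 ≤ N) (e : E N ≃L[ℝ] E (N - 1) × ℝ) {γ : E (N - 1) → ℝ}
    {L : ℝ≥0} (hγ : LipschitzWith L γ) {B : Set (E (N - 1))} {G D : Set (E N)} {r : ℝ} (hr : 0 < r)
    (hB : MeasurableSet B) (hD : MeasurableSet D) (hG : G ⊆ (fun x => e.symm (x, γ x)) '' B)
    (hBD : ∀ x ∈ B, ∀ t ∈ Ioo 0 r, e.symm (x, γ x + t) ∈ D) :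
    DominatedOnC1 (fun φ => eLpNorm φ 1 ((Measure.hausdorffMeasure ((N : ℝ) - 1)).restrict G))
      fun φ => eLpNorm φ 1 (volume.restrict D) + eLpNorm (fderiv ℝ φ) 1 (volume.restrict D) := by
  have hdim : (N : ℝ) - 1 = Module.finrank ℝ (E (N - 1)) := by simp [Nat.cast_sub hN]
  set ν : Measure (E (N - 1)) := Measure.hausdorffMeasure ((N : ℝ) - 1)
  have : ν.IsAddHaarMeasure := by
    simp only [ν, hdim]
    infer_instance
  obtain ⟨K, hg⟩ : ∃ K, LipschitzWith K fun x => e.symm (x, γ x) :=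
    ⟨_, e.symm.lipschitz.comp (LipschitzWith.id.prodMk hγ)⟩
  obtain ⟨C, hC⟩ := exists_eLpNorm_one_graph_le (Z := ℝ) volume ν e hr
  refine ⟨K ^ ((N : ℝ) - 1) * C, fun φ hφ => ?_⟩
  calc eLpNorm φ 1 ((Measure.hausdorffMeasure ((N : ℝ) - 1)).restrict G)
      ≤ eLpNorm φ 1 (((K : ℝ≥0∞) ^ ((N : ℝ) - 1)) •
          Measure.map (fun x => e.symm (x, γ x)) (ν.restrict B)) :=
        eLpNorm_mono_measure _ (restrict_hausdorffMeasure_le_smul_map hg (by simp [hdim]) hG)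
    _ = (K : ℝ≥0∞) ^ ((N : ℝ) - 1) * ∫⁻ x in B, ‖φ (e.symm (x, γ x))‖ₑ ∂ν := by
        rw [eLpNorm_one_eq_lintegral_enorm, lintegral_smul_measure, smul_eq_mul,
          lintegral_map hφ.continuous.enorm.measurable hg.continuous.measurable]
    _ ≤ _ := by
        rw [ENNReal.coe_mul, mul_assoc, ENNReal.coe_rpow_of_nonneg _ (by simp [hdim])]
        gcongr
        exact hC γ B D hγ.continuous hB hD hBD φ hφ

lemma exists_isTraceChart_of_mem_frontier (hN : 1 ≤ N) (hΩ : IsOpen Ω) (hL : IsLipschitzSet Ω)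
    {P : E N} (hP : P ∈ frontier Ω) : ∃ K b ρ, P ∈ K ∧ IsTraceChart Ω K b ρ := by
  obtain ⟨A, U, γ, L, hU, hPU, hγ, hUΩ⟩ := hL P hP
  let e : E N ≃L[ℝ] E (N - 1) × ℝ :=
    A.toContinuousLinearEquiv.trans (WithLp.prodContinuousLinearEquiv 2 ℝ (E (N - 1)) ℝ)
  have hUΩ' : U ∩ Ω = U ∩ e ⁻¹' {w | γ w.1 < w.2} := hUΩ
  have hgraph : ∀ y ∈ U ∩ frontier Ω, e.symm ((e y).1, γ (e y).1) = y := fun y hy => by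
    have hy' : γ (e y).1 = (e y).2 := inter_frontier_subset_eq hU
      (hγ.continuous.comp (continuous_fst.comp e.continuous)) (continuous_snd.comp e.continuous)
      hUΩ' hy
    rw [hy', Prod.mk.eta, e.symm_apply_apply]
  set x := (e P).1
  obtain ⟨r, hr, hrU⟩ : ∃ r > 0, graphBox γ L x r ⊆ e.symm ⁻¹' U :=
    exists_graphBox_subset L <| e.symm.continuous.continuousAt.preimage_mem_nhds <| by
      rw [hgraph P ⟨hPU, hP⟩]
      exact hU.mem_nhds hPU
  set K := e ⁻¹' graphBox γ L x r
  have hKU : K ⊆ U := fun y hy => by simpa using hrU hy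
  have hKo : IsOpen K := (Metric.isOpen_ball.prod Metric.isOpen_ball).preimage e.continuous
  have hKΩ : K ∩ Ω = e ⁻¹' (graphBox γ L x r ∩ {w | γ w.1 < w.2}) := by
    rw [preimage_inter, ← inter_eq_left.2 hKU, inter_assoc, hUΩ', ← inter_assoc,
      inter_eq_left.2 hKU]
  have hPK : P ∈ K := by
    rw [← hgraph P ⟨hPU, hP⟩, mem_preimage, e.apply_symm_apply]
    exact ⟨Metric.mem_ball_self hr, Metric.mem_ball_self (by positivity)⟩
  set b := e.symm (x, γ x + (3 * L + 1) * r) with hb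
  have hstar : ∀ᶠ y in 𝓝 b, StarConvex ℝ y (K ∩ Ω) := by
    have heb : Tendsto e (𝓝 b) (𝓝 (x, γ x + (3 * L + 1) * r)) := by
      simpa [hb] using e.continuous.tendsto b
    filter_upwards [heb.eventually
      (eventually_starConvex_graphBox_inter_epigraph hγ x hr)] with y hy
    rw [hKΩ]
    exact hy.linear_preimage (e : E N →ₗ[ℝ] E (N - 1) × ℝ)
  obtain ⟨ρ, hρ, hball⟩ := Metric.eventually_nhds_iff_ball.1 hstar
  refine ⟨K, b, ρ, hPK, hKo, hρ, hball, ?_⟩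
  rw [surf, Measure.restrict_restrict hKo.measurableSet]
  refine trace_of_subset_graph hN e hγ hr measurableSet_ball (hKo.inter hΩ).measurableSet
    (fun y hy => ⟨(e y).1, hy.1.1, hgraph y ⟨hKU hy.1, hy.2⟩⟩) fun y hy t ht => ?_
  rw [hKΩ, mem_preimage, e.apply_symm_apply]
  exact ⟨mem_graphBox_of_mem_Ioo hγ hy ht, lt_add_of_pos_right _ ht.1⟩

lemma IsBoundedLipschitzDomain.exists_isTraceChart (hN : 1 ≤ N) (hΩ : IsBoundedLipschitzDomain Ω)
    {P : E N} (hP : P ∈ closure Ω) : ∃ K b ρ, P ∈ K ∧ IsTraceChart Ω K b ρ := by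
  rcases closure_eq_self_union_frontier Ω ▸ hP with hP | hP
  · exact exists_isTraceChart_of_mem hΩ.isOpen hP
  · exact exists_isTraceChart_of_mem_frontier hN hΩ.isOpen hΩ.isLipschitz hP

end Chart

section RestrictUnion

variable {α F : Type*} [MeasurableSpace α] [NormedAddCommGroup F] {p : ℝ≥0∞}

lemma eLpNorm_add_measure_le (hp : 1 ≤ p) (hp' : p ≠ ⊤) (f : α → F) (μ ν : Measure α) :
    eLpNorm f p (μ + ν) ≤ eLpNorm f p μ + eLpNorm f p ν := by
  have hp1 : 1 ≤ p.toReal := by simpa using ENNReal.toReal_mono hp' hp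
  simp only [eLpNorm_eq_lintegral_rpow_enorm_toReal (zero_lt_one.trans_le hp).ne' hp',
    lintegral_add_measure, one_div]
  exact ENNReal.rpow_add_le_add_rpow _ _ (by positivity) (inv_le_one_of_one_le₀ hp1)

lemma eLpNorm_restrict_union_le (hp : 1 ≤ p) (hp' : p ≠ ⊤) (f : α → F) (μ : Measure α)
    (s t : Set α) : eLpNorm f p (μ.restrict (s ∪ t)) ≤
      eLpNorm f p (μ.restrict s) + eLpNorm f p (μ.restrict t) :=
  (eLpNorm_mono_measure f (Measure.restrict_union_le s t)).trans
    (eLpNorm_add_measure_le hp hp' f _ _)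

end RestrictUnion

namespace DominatedOnC1

variable {F : Type*} [NormedAddCommGroup F] [NormedSpace ℝ F] {P Q R : (F → ℝ) → ℝ≥0∞}
  {c : ℝ≥0∞}

lemma of_le (h : ∀ φ, ContDiff ℝ 1 φ → P φ ≤ Q φ) : DominatedOnC1 P Q :=
  ⟨1, fun φ hφ => by simpa using h φ hφ⟩

lemma trans (hPQ : DominatedOnC1 P Q) (hQR : DominatedOnC1 Q R) : DominatedOnC1 P R := by
  obtain ⟨C, hC⟩ := hPQ
  obtain ⟨D, hD⟩ := hQR
  refine ⟨C * D, fun φ hφ => ?_⟩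
  grw [hC φ hφ, hD φ hφ, ENNReal.coe_mul, mul_assoc]

lemma of_le_of_dominated (h : ∀ φ, ContDiff ℝ 1 φ → P φ ≤ Q φ) (hQR : DominatedOnC1 Q R) :
    DominatedOnC1 P R :=
  (of_le h).trans hQR

lemma add (hP : DominatedOnC1 P R) (hQ : DominatedOnC1 Q R) :
    DominatedOnC1 (fun φ => P φ + Q φ) R := by
  obtain ⟨C, hC⟩ := hP
  obtain ⟨D, hD⟩ := hQ
  refine ⟨C + D, fun φ hφ => ?_⟩
  rw [ENNReal.coe_add, add_mul]
  exact add_le_add (hC φ hφ) (hD φ hφ)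

lemma const_mul (hc : c ≠ ⊤) (hP : DominatedOnC1 P Q) :
    DominatedOnC1 (fun φ => c * P φ) Q := by
  obtain ⟨C, hC⟩ := hP
  refine ⟨c.toNNReal * C, fun φ hφ => ?_⟩
  rw [ENNReal.coe_mul, ENNReal.coe_toNNReal hc, mul_assoc]
  exact mul_le_mul_right (hC φ hφ) c

lemma of_const_mul (hc₀ : c ≠ 0) (hc : c ≠ ⊤) (h : DominatedOnC1 (fun φ => c * P φ) Q) :
    DominatedOnC1 P Q :=
  of_le_of_dominated (fun φ _ => (ENNReal.inv_mul_cancel_left' (by simp [hc₀]) (by simp [hc])).ge)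
    (h.const_mul (ENNReal.inv_ne_top.2 hc₀))

end DominatedOnC1

section PoincareSobolev

variable {N : ℕ} {Ω K : Set (E N)}

lemma isFiniteMeasure_restrict_of_isBounded (hΩ : Bornology.IsBounded Ω) :
    IsFiniteMeasure (volume.restrict Ω) :=
  isFiniteMeasure_restrict.2 hΩ.measure_lt_top.ne

lemma IsTraceChart.surf_lt_top {b : E N} {ρ : ℝ} (hK : IsTraceChart Ω K b ρ)
    (hΩ : Bornology.IsBounded Ω) : surf Ω K < ⊤ := by
  obtain ⟨C, hC⟩ := hK.trace
  have h : surf Ω K ≤ C * volume (K ∩ Ω) := by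
    have h := hC (fun _ => 1) contDiff_const
    have h₀ : eLpNorm (fderiv ℝ fun _ : E N => (1 : ℝ)) 1 (volume.restrict (K ∩ Ω)) = 0 := by
      simp [eLpNorm_one_eq_lintegral_enorm, ← ofReal_norm]
    beta_reduce at h
    rw [h₀, add_zero] at h
    simpa [eLpNorm_one_eq_lintegral_enorm] using h
  exact h.trans_lt (ENNReal.mul_lt_top ENNReal.coe_lt_top
    (hΩ.subset inter_subset_right).measure_lt_top)

lemma IsBoundedLipschitzDomain.isFiniteMeasure_surf (hN : 1 ≤ N)
    (hΩ : IsBoundedLipschitzDomain Ω) : IsFiniteMeasure (surf Ω) := by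
  refine ⟨?_⟩
  rw [surf, Measure.restrict_apply_univ, ← Measure.restrict_apply_self, ← surf]
  refine (hΩ.isBounded.isCompact_closure.of_isClosed_subset isClosed_frontier
    frontier_subset_closure).measure_lt_top_of_nhdsWithin fun P hP => ?_
  obtain ⟨K, b, ρ, hPK, hK⟩ := hΩ.exists_isTraceChart hN (frontier_subset_closure hP)
  exact ⟨K, mem_nhdsWithin_of_mem_nhds (hK.isOpen.mem_nhds hPK), hK.surf_lt_top hΩ.isBounded⟩

/-- On `K`, each `C¹` function `φ` is approximated by the constant `c φ`, in `L^p(K ∩ Ω)` and in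
`L¹(K ∩ ∂Ω)`, up to a multiple of the `L^a` norm of its gradient on the whole of `Ω`. -/
structure IsLocalMean (Ω : Set (E N)) (a p : ℝ≥0∞) (c : (E N → ℝ) → ℝ) (K : Set (E N)) :
    Prop where
  interior : DominatedOnC1 (fun φ => eLpNorm (fun x => φ x - c φ) p (volume.restrict (K ∩ Ω)))
    fun φ => eLpNorm (fderiv ℝ φ) a (volume.restrict Ω)
  boundary : DominatedOnC1 (fun φ => eLpNorm (fun x => φ x - c φ) 1 ((surf Ω).restrict K))
    fun φ => eLpNorm (fderiv ℝ φ) a (volume.restrict Ω)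

lemma dominatedOnC1_eLpNorm_fderiv (hΩ : Bornology.IsBounded Ω) {D : Set (E N)} (hD : D ⊆ Ω)
    {a₁ a : ℝ≥0∞} (ha : a₁ ≤ a) (ha₁ : a₁ ≠ 0) :
    DominatedOnC1 (fun φ => eLpNorm (fderiv ℝ φ) a₁ (volume.restrict D))
      fun φ => eLpNorm (fderiv ℝ φ) a (volume.restrict Ω) := by
  have hvol : volume D ^ (1 / a₁.toReal - 1 / a.toReal) ≠ ⊤ := by
    refine ENNReal.rpow_ne_top_of_nonneg (sub_nonneg.2 ?_) (hΩ.subset hD).measure_lt_top.ne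
    simpa [ENNReal.toReal_inv] using ENNReal.toReal_mono (by simpa) (ENNReal.inv_le_inv.2 ha)
  refine .of_le_of_dominated (fun φ hφ => ?_) <| (DominatedOnC1.of_le fun φ _ =>
    eLpNorm_mono_measure (fderiv ℝ φ) (Measure.restrict_mono_set volume hD)).const_mul hvol
  simpa [mul_comm] using eLpNorm_le_eLpNorm_mul_rpow_measure_univ (μ := volume.restrict D) ha
    (hφ.continuous_fderiv one_ne_zero).aestronglyMeasurable

lemma IsTraceChart.isLocalMean (hN : 1 ≤ N) {b : E N} {ρ : ℝ} (hK : IsTraceChart Ω K b ρ)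
    (hΩo : IsOpen Ω) (hΩ : Bornology.IsBounded Ω) {a p : ℝ} (ha : 1 ≤ a) (hap : a ≤ p)
    (hpa : 1 / a - 1 / N < 1 / p) :
    IsLocalMean Ω (.ofReal a) (.ofReal p) (fun φ => ⨍ y in Metric.ball b ρ, φ y) K := by
  have : Nontrivial (E N) := Module.nontrivial_of_finrank_pos (R := ℝ) <| by
    rwa [finrank_euclideanSpace_fin]
  have hD := (hK.isOpen.inter hΩo).measurableSet
  have hDb : Bornology.IsBounded (K ∩ Ω) := hΩ.subset inter_subset_right
  have hfd {a₁ : ℝ} (ha₁ : 1 ≤ a₁) (h : a₁ ≤ a) :=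
    dominatedOnC1_eLpNorm_fderiv hΩ (inter_subset_right (s := K)) (ENNReal.ofReal_le_ofReal h)
      (by simpa using zero_lt_one.trans_le ha₁)
  have hmean₁ : DominatedOnC1 _ _ := exists_eLpNorm_sub_average_ball_le (μ := volume) (V := ℝ)
    hD hDb hK.radius_pos hK.starConvex le_rfl le_rfl (by simpa using Nat.zero_lt_of_lt hN)
  refine ⟨DominatedOnC1.trans (exists_eLpNorm_sub_average_ball_le hD hDb hK.radius_pos
    hK.starConvex ha hap (by simpa using hpa)) (hfd ha le_rfl), ?_⟩
  simp only [ENNReal.ofReal_one] at hmean₁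
  have hfd₁ := hfd le_rfl ha
  simp only [ENNReal.ofReal_one] at hfd₁
  obtain ⟨C, hC⟩ := hK.trace
  refine DominatedOnC1.trans ⟨C, fun φ hφ => ?_⟩ ((hmean₁.trans hfd₁).add hfd₁)
  have hsub (d : ℝ) : fderiv ℝ (fun x => φ x - d) = fderiv ℝ φ :=
    funext fun x => fderiv_sub_const d
  simpa only [hsub] using hC (fun x => φ x - ⨍ y in Metric.ball b ρ, φ y) (hφ.sub contDiff_const)

namespace IsLocalMean

variable {a p : ℝ≥0∞} {c c' : (E N → ℝ) → ℝ} {K' : Set (E N)}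

lemma mono (h : IsLocalMean Ω a p c K') (hK : K ⊆ K') : IsLocalMean Ω a p c K where
  interior := h.interior.of_le_of_dominated fun _ _ =>
    eLpNorm_mono_measure _ (Measure.restrict_mono_set _ (inter_subset_inter_left Ω hK))
  boundary := h.boundary.of_le_of_dominated fun _ _ =>
    eLpNorm_mono_measure _ (Measure.restrict_mono_set _ hK)

lemma empty : IsLocalMean Ω a p c ∅ where
  interior := .of_le fun φ _ => by simp
  boundary := .of_le fun φ _ => by simp

lemma union (hp : 1 ≤ p) (hp' : p ≠ ⊤) (h : IsLocalMean Ω a p c K)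
    (h' : IsLocalMean Ω a p c K') : IsLocalMean Ω a p c (K ∪ K') where
  interior := (h.interior.add h'.interior).of_le_of_dominated fun φ _ => by
    rw [union_inter_distrib_right]
    exact eLpNorm_restrict_union_le hp hp' _ _ _ _
  boundary := (h.boundary.add h'.boundary).of_le_of_dominated fun φ _ =>
    eLpNorm_restrict_union_le le_rfl ENNReal.one_ne_top _ _ _ _

lemma dominatedOnC1_enorm_sub (hp : 1 ≤ p) (hp' : p ≠ ⊤) (h : IsLocalMean Ω a p c K)
    (h' : IsLocalMean Ω a p c' K) (hK₀ : volume (K ∩ Ω) ≠ 0) (hK : volume (K ∩ Ω) ≠ ⊤) :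
    DominatedOnC1 (fun φ => ‖c φ - c' φ‖ₑ) fun φ => eLpNorm (fderiv ℝ φ) a (volume.restrict Ω) := by
  have hp0 : p ≠ 0 := (zero_lt_one.trans_le hp).ne'
  refine .of_const_mul (c := volume (K ∩ Ω) ^ (1 / p.toReal)) (by simp [hK₀, hK])
    (ENNReal.rpow_ne_top_of_nonneg (by positivity) hK) <|
    (h'.interior.add h.interior).of_le_of_dominated fun φ hφ => ?_
  have hmeas (d : ℝ) : AEStronglyMeasurable (fun x => φ x - d) (volume.restrict (K ∩ Ω)) :=
    (hφ.continuous.sub continuous_const).aestronglyMeasurable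
  calc volume (K ∩ Ω) ^ (1 / p.toReal) * ‖c φ - c' φ‖ₑ
      = eLpNorm (fun _ => c φ - c' φ) p (volume.restrict (K ∩ Ω)) := by
        rw [eLpNorm_const' _ hp0 hp', Measure.restrict_apply_univ, mul_comm]
    _ = eLpNorm ((fun x => φ x - c' φ) - fun x => φ x - c φ) p (volume.restrict (K ∩ Ω)) := by
        congr 1
        ext x
        simp
    _ ≤ _ := eLpNorm_sub_le (hmeas _) (hmeas _) hp

lemma congr [IsFiniteMeasure (surf Ω)] (hp : 1 ≤ p) (hp' : p ≠ ⊤)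
    (hΩ : volume (K ∩ Ω) ≠ ⊤) (h : IsLocalMean Ω a p c K)
    (hc : DominatedOnC1 (fun φ => ‖c φ - c' φ‖ₑ)
      fun φ => eLpNorm (fderiv ℝ φ) a (volume.restrict Ω)) : IsLocalMean Ω a p c' K := by
  have key (φ : E N → ℝ) (hφ : ContDiff ℝ 1 φ) {q : ℝ≥0∞} (hq : 1 ≤ q) (hq' : q ≠ ⊤)
      (μ : Measure (E N)) : eLpNorm (fun x => φ x - c' φ) q μ ≤
        eLpNorm (fun x => φ x - c φ) q μ + μ univ ^ (1 / q.toReal) * ‖c φ - c' φ‖ₑ := by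
    rw [mul_comm, ← eLpNorm_const' _ (zero_lt_one.trans_le hq).ne' hq']
    refine le_of_eq_of_le ?_ (eLpNorm_add_le ?_ aestronglyMeasurable_const hq)
    · congr 1
      ext x
      simp
    · exact (hφ.continuous.sub continuous_const).aestronglyMeasurable
  refine ⟨(h.interior.add (hc.const_mul ?_)).of_le_of_dominated fun φ hφ => key φ hφ hp hp' _,
    (h.boundary.add (hc.const_mul ?_)).of_le_of_dominated fun φ hφ => key φ hφ le_rfl (by simp) _⟩
  · exact ENNReal.rpow_ne_top_of_nonneg (by positivity) (by simpa using hΩ)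
  · exact ENNReal.rpow_ne_top_of_nonneg (by positivity) (measure_ne_top _ _)

end IsLocalMean

theorem IsBoundedLipschitzDomain.exists_isLocalMean (hN : 1 ≤ N)
    (hΩ : IsBoundedLipschitzDomain Ω) {a p : ℝ} (ha : 1 ≤ a) (hap : a ≤ p)
    (hpa : 1 / a - 1 / N < 1 / p) :
    ∃ c, IsLocalMean Ω (.ofReal a) (.ofReal p) c (closure Ω) := by
  have := hΩ.isFiniteMeasure_surf hN
  have hp : 1 ≤ ENNReal.ofReal p := by simpa using ha.trans hap
  have hvol (K : Set (E N)) : volume (K ∩ Ω) ≠ ⊤ :=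
    (hΩ.isBounded.subset inter_subset_right).measure_lt_top.ne
  have hchart : ∀ P ∈ closure Ω, ∃ K, IsOpen K ∧ P ∈ K ∧
      ∃ c, IsLocalMean Ω (.ofReal a) (.ofReal p) c K := fun P hP => by
    obtain ⟨K, b, ρ, hPK, hK⟩ := hΩ.exists_isTraceChart hN hP
    exact ⟨K, hK.isOpen, hPK, _, hK.isLocalMean hN hΩ.isOpen hΩ.isBounded ha hap hpa⟩
  obtain ⟨P₀, hP₀⟩ := hΩ.isConnected.nonempty
  obtain ⟨K₀, hK₀, hP₀K, c, hc⟩ := hchart P₀ (subset_closure hP₀)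
  let G : Set (E N) := ⋃₀ {K | IsOpen K ∧ IsLocalMean Ω (.ofReal a) (.ofReal p) c K}
  have hclosure : closure (Ω ∩ G) ⊆ G := fun P hP => by
    obtain ⟨K, hK, hPK, c', hc'⟩ := hchart P (closure_mono inter_subset_left hP)
    obtain ⟨Q, hQK, hQΩ, K', ⟨hK', hcK'⟩, hQK'⟩ := mem_closure_iff.1 hP K hK hPK
    have hpos : volume (K ∩ K' ∩ Ω) ≠ 0 :=
      ((hK.inter hK').inter hΩ.isOpen).measure_ne_zero _ ⟨Q, ⟨hQK, hQK'⟩, hQΩ⟩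
    exact ⟨K, ⟨hK, hc'.congr hp ENNReal.ofReal_ne_top (hvol K) <|
      (hc'.mono inter_subset_left).dominatedOnC1_enorm_sub hp ENNReal.ofReal_ne_top
        (hcK'.mono inter_subset_right) hpos (hvol _)⟩, hPK⟩
  have hΩG : Ω ⊆ Ω ∩ G := hΩ.isConnected.isPreconnected.subset_of_closure_inter_subset
    (hΩ.isOpen.inter (isOpen_sUnion fun K hK => hK.1)) ⟨P₀, hP₀, hP₀, K₀, ⟨hK₀, hc⟩, hP₀K⟩
    fun P hP => ⟨hP.2, hclosure hP.1⟩
  have hG : closure Ω ⊆ G := (closure_mono hΩG).trans hclosure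
  refine ⟨c, hΩ.isBounded.isCompact_closure.induction_on .empty (fun _ _ h h' => h'.mono h)
    (fun _ _ => .union hp ENNReal.ofReal_ne_top) fun P hP => ?_⟩
  obtain ⟨K, ⟨hK, hcK⟩, hPK⟩ := hG hP
  exact ⟨K, mem_nhdsWithin_of_mem_nhds (hK.mem_nhds hPK), hcK⟩

lemma surf_restrict_le_restrict_closure (S : Set (E N)) :
    (surf Ω).restrict S ≤ (surf Ω).restrict (closure Ω) := by
  refine Measure.restrict_le_self.trans_eq ?_
  rw [surf, Measure.restrict_restrict isClosed_closure.measurableSet,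
    inter_eq_self_of_subset_right frontier_subset_closure]

theorem IsBoundedLipschitzDomain.dominatedOnC1_eLpNorm (hN : 1 ≤ N)
    (hΩ : IsBoundedLipschitzDomain Ω) {a p : ℝ} (ha : 1 ≤ a) (hap : a ≤ p)
    (hpa : 1 / a - 1 / N < 1 / p) {S : Set (E N)} (hS : surf Ω S ≠ 0) :
    DominatedOnC1 (fun φ => eLpNorm φ (.ofReal p) (volume.restrict Ω)) fun φ =>
      eLpNorm φ 1 ((surf Ω).restrict S) + eLpNorm (fderiv ℝ φ) (.ofReal a) (volume.restrict Ω) := by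
  have := hΩ.isFiniteMeasure_surf hN
  have := isFiniteMeasure_restrict_of_isBounded hΩ.isBounded
  have hp : 1 ≤ ENNReal.ofReal p := by simpa using ha.trans hap
  have hp0 : ENNReal.ofReal p ≠ 0 := (zero_lt_one.trans_le hp).ne'
  obtain ⟨c, hc⟩ := hΩ.exists_isLocalMean hN ha hap hpa
  have hcont {φ : E N → ℝ} (hφ : ContDiff ℝ 1 φ) (μ : Measure (E N)) :
      AEStronglyMeasurable (fun x => φ x - c φ) μ :=
    (hφ.continuous.sub continuous_const).aestronglyMeasurable
  let R : (E N → ℝ) → ℝ≥0∞ := fun φ =>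
    eLpNorm φ 1 ((surf Ω).restrict S) + eLpNorm (fderiv ℝ φ) (.ofReal a) (volume.restrict Ω)
  have hgrad : DominatedOnC1 (fun φ => eLpNorm (fderiv ℝ φ) (.ofReal a) (volume.restrict Ω)) R :=
    .of_le fun φ _ => le_add_self
  have hdata : DominatedOnC1 (fun φ => eLpNorm φ 1 ((surf Ω).restrict S)) R :=
    .of_le fun φ _ => le_self_add
  have hconst : DominatedOnC1 (fun φ => ‖c φ‖ₑ) R := by
    refine .of_const_mul (c := surf Ω S) hS (measure_ne_top _ _) <|
      (hdata.add (hc.boundary.trans hgrad)).of_le_of_dominated fun φ hφ => ?_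
    calc surf Ω S * ‖c φ‖ₑ = eLpNorm (φ - fun x => φ x - c φ) 1 ((surf Ω).restrict S) := by
          rw [show (φ - fun x => φ x - c φ) = fun _ => c φ by ext x; simp,
            eLpNorm_const' _ one_ne_zero ENNReal.one_ne_top]
          simp [mul_comm]
      _ ≤ _ := eLpNorm_sub_le hφ.continuous.aestronglyMeasurable (hcont hφ _) le_rfl
      _ ≤ _ := add_le_add_right
        (eLpNorm_mono_measure _ (surf_restrict_le_restrict_closure S)) _
  refine ((hc.interior.trans hgrad).add (hconst.const_mul
    (c := volume Ω ^ (1 / (ENNReal.ofReal p).toReal)) <| ENNReal.rpow_ne_top_of_nonneg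
      (by positivity) hΩ.isBounded.measure_lt_top.ne)).of_le_of_dominated fun φ hφ => ?_
  rw [inter_eq_self_of_subset_right subset_closure]
  calc eLpNorm φ (.ofReal p) (volume.restrict Ω)
      = eLpNorm ((fun x => φ x - c φ) + fun _ => c φ) (.ofReal p) (volume.restrict Ω) := by
        congr 1
        ext x
        simp
    _ ≤ _ := eLpNorm_add_le (hcont hφ _) aestronglyMeasurable_const hp
    _ = _ := by
        rw [eLpNorm_const' _ hp0 ENNReal.ofReal_ne_top, Measure.restrict_apply_univ,
          mul_comm ‖c φ‖ₑ]

end PoincareSobolev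

section LpConvergence

variable {α F : Type*} [MeasurableSpace α] [NormedAddCommGroup F] {μ : Measure α} {p q : ℝ≥0∞}

lemma tendsto_eLpNorm_zero_of_dominated (hp : p ≠ ⊤) {f : ℕ → α → F} {bound : α → ℝ}
    (hf : ∀ k, AEStronglyMeasurable (f k) μ) (hbound : MemLp bound p μ)
    (hle : ∀ k x, ‖f k x‖ ≤ bound x) (h : ∀ᵐ x ∂μ, Tendsto (fun k => f k x) atTop (𝓝 0)) :
    Tendsto (fun k => eLpNorm (f k) p μ) atTop (𝓝 0) := by
  rcases eq_or_ne p 0 with rfl | hp₀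
  · simp
  have hp' : 0 < p.toReal := ENNReal.toReal_pos hp₀ hp
  have hrpow (r : ℝ) (hr : 0 < r) : Tendsto (fun y : ℝ≥0∞ => y ^ r) (𝓝 0) (𝓝 0) := by
    simpa [hr] using (ENNReal.continuous_rpow_const (y := r)).tendsto 0
  have hint : Tendsto (fun k => ∫⁻ x, ‖f k x‖ₑ ^ p.toReal ∂μ) atTop (𝓝 (∫⁻ _, 0 ∂μ)) := by
    refine tendsto_lintegral_of_dominated_convergence' (fun x => ‖bound x‖ₑ ^ p.toReal)
      (fun k => (hf k).enorm.pow_const _) (fun k => .of_forall fun x => ?_)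
      (lintegral_rpow_enorm_lt_top_of_eLpNorm_lt_top hp₀ hp hbound.2).ne ?_
    · exact ENNReal.rpow_le_rpow (enorm_le_iff_norm_le.2 ((hle k x).trans (le_abs_self _))) hp'.le
    · filter_upwards [h] with x hx
      exact (hrpow _ hp').comp (by simpa using hx.enorm)
  rw [lintegral_zero] at hint
  simp only [eLpNorm_eq_lintegral_rpow_enorm_toReal hp₀ hp]
  exact (hrpow _ (by positivity)).comp hint

lemma eLpNorm_smul_le_of_norm_le [NormedSpace ℝ F] {a : α → ℝ} {M : ℝ≥0} (ha : ∀ x, ‖a x‖ ≤ M)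
    (X : α → F) : eLpNorm (fun x => a x • X x) p μ ≤ M * eLpNorm X p μ := by
  simpa [ENNReal.smul_def] using eLpNorm_le_nnreal_smul_eLpNorm_of_ae_le_mul (c := M)
    (.of_forall fun x => by grw [nnnorm_smul, show ‖a x‖₊ ≤ M from ha x]) p

lemma tendsto_eLpNorm_smul_sub_smul [NormedSpace ℝ F] (hp : 1 ≤ p) (hp' : p ≠ ⊤)
    {a : ℕ → α → ℝ} {a' : α → ℝ} {X : ℕ → α → F} {X' : α → F} {M : ℝ≥0}
    (ha : ∀ k, AEStronglyMeasurable (a k) μ) (ha' : AEStronglyMeasurable a' μ)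
    (hX : ∀ k, AEStronglyMeasurable (X k) μ) (hX' : MemLp X' p μ) (haM : ∀ k x, ‖a k x‖ ≤ M)
    (haM' : ∀ x, ‖a' x‖ ≤ M) (hlim : ∀ᵐ x ∂μ, Tendsto (fun k => a k x) atTop (𝓝 (a' x)))
    (hXlim : Tendsto (fun k => eLpNorm (fun x => X k x - X' x) p μ) atTop (𝓝 0)) :
    Tendsto (fun k => eLpNorm (fun x => a k x • X k x - a' x • X' x) p μ) atTop (𝓝 0) := by
  have hfactor : Tendsto (fun k => eLpNorm (fun x => (a k x - a' x) • X' x) p μ) atTop (𝓝 0) := by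
    refine tendsto_eLpNorm_zero_of_dominated hp' (bound := fun x => (M + M) * ‖X' x‖)
      (fun k => ((ha k).sub ha').smul hX'.1) (hX'.norm.const_mul _) (fun k x => ?_) ?_
    · grw [norm_smul, norm_sub_le, haM, haM']
    · filter_upwards [hlim] with x hx
      simpa using (hx.sub_const (a' x)).smul_const (X' x)
  have hsum := (ENNReal.Tendsto.const_mul hXlim (.inr (ENNReal.coe_ne_top (r := M)))).add hfactor
  rw [mul_zero, add_zero] at hsum
  refine tendsto_nhds_bot_mono' hsum fun k => ?_
  calc eLpNorm (fun x => a k x • X k x - a' x • X' x) p μ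
      = eLpNorm ((fun x => a k x • (X k x - X' x)) + fun x => (a k x - a' x) • X' x) p μ := by
        congr 1
        ext x
        simp only [Pi.add_apply]
        module
    _ ≤ _ := eLpNorm_add_le ((ha k).smul ((hX k).sub hX'.1)) (((ha k).sub ha').smul hX'.1) hp
    _ ≤ _ := add_le_add_left (eLpNorm_smul_le_of_norm_le (haM k) _) _

lemma tendsto_eLpNorm_comp_sub_comp {Ψ : ℝ → ℝ} {M : ℝ≥0} (hΨ : LipschitzWith M Ψ)
    {f : ℕ → α → ℝ} {g : α → ℝ}
    (h : Tendsto (fun k => eLpNorm (fun x => f k x - g x) p μ) atTop (𝓝 0)) :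
    Tendsto (fun k => eLpNorm (fun x => Ψ (f k x) - Ψ (g x)) p μ) atTop (𝓝 0) := by
  have hM := ENNReal.Tendsto.const_mul h (.inr (ENNReal.coe_ne_top (r := M)))
  rw [mul_zero] at hM
  refine tendsto_nhds_bot_mono' hM fun k => ?_
  simpa [ENNReal.smul_def] using eLpNorm_le_nnreal_smul_eLpNorm_of_ae_le_mul (c := M)
    (f := fun x => Ψ (f k x) - Ψ (g x)) (g := fun x => f k x - g x)
    (.of_forall fun x => by simpa [← nndist_eq_nnnorm] using hΨ.nndist_le (f k x) (g x)) p

lemma tendsto_integral_mul_of_tendsto_eLpNorm [ENNReal.HolderConjugate p q] {f : ℕ → α → ℝ}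
    {g η : α → ℝ} (hf : ∀ k, AEStronglyMeasurable (f k) μ) (hg : MemLp g p μ) (hη : MemLp η q μ)
    (h : Tendsto (fun k => eLpNorm (fun x => f k x - g x) p μ) atTop (𝓝 0)) :
    Tendsto (fun k => ∫ x, f k x * η x ∂μ) atTop (𝓝 (∫ x, g x * η x ∂μ)) := by
  have hgη : Integrable (fun x => g x * η x) μ := hg.integrable_mul hη
  refine tendsto_integral_of_L1' _ hgη.aestronglyMeasurable ?_ ?_
  · filter_upwards [h.eventually_lt_const ENNReal.zero_lt_top] with k hk
    have hdiff : MemLp (fun x => f k x - g x) p μ := ⟨(hf k).sub hg.1, hk⟩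
    exact ((hdiff.integrable_mul hη).add hgη).congr (.of_forall fun x => by
      simp [sub_mul])
  · have h₀ := ENNReal.Tendsto.mul_const h (.inr hη.eLpNorm_ne_top)
    rw [zero_mul] at h₀
    refine tendsto_nhds_bot_mono' h₀ fun k => ?_
    calc eLpNorm (fun x => f k x * η x - g x * η x) 1 μ
        = eLpNorm ((fun x => f k x - g x) • η) 1 μ := by
          congr 1
          ext x
          simp [sub_mul]
      _ ≤ _ := eLpNorm_smul_le_mul_eLpNorm hη.1 ((hf k).sub hg.1)

lemma eLpNorm_one_restrict_le_of_ae_eq_zero {S : Set α} {f g : α → F}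
    (hf : AEStronglyMeasurable f μ) (hg : AEStronglyMeasurable g μ) (h : g =ᵐ[μ.restrict S] 0) :
    eLpNorm f 1 (μ.restrict S) ≤ eLpNorm (fun x => f x - g x) 2 μ * μ S ^ (1 / 2 : ℝ) := by
  have hae : f =ᵐ[μ.restrict S] fun x => f x - g x := by
    filter_upwards [h] with x hx
    simp [hx]
  calc eLpNorm f 1 (μ.restrict S)
      ≤ eLpNorm (fun x => f x - g x) 2 (μ.restrict S) * μ S ^ (1 / 2 : ℝ) := by
        rw [eLpNorm_congr_ae hae]
        have := eLpNorm_le_eLpNorm_mul_rpow_measure_univ (μ := μ.restrict S) one_le_two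
          (hf.sub hg).restrict
        rwa [Measure.restrict_apply_univ, ENNReal.toReal_one, ENNReal.toReal_ofNat,
          show (1 / 1 - 1 / 2 : ℝ) = 1 / 2 by norm_num] at this
    _ ≤ _ := mul_le_mul_left (eLpNorm_restrict_le _ _ _ _) _

end LpConvergence

section WeakGradient

variable {N : ℕ} {Ω : Set (E N)} {u v φ : E N → ℝ} {G H : E N → E N} {p : ℝ≥0∞}

lemma gradient_apply (φ : E N → ℝ) (x : E N) (i : Fin N) :
    gradient φ x i = fderiv ℝ φ x (EuclideanSpace.single i 1) := by
  rw [← inner_gradient_left, EuclideanSpace.inner_single_right]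
  simp

lemma eLpNorm_gradient (φ : E N → ℝ) (p : ℝ≥0∞) (μ : Measure (E N)) :
    eLpNorm (gradient φ) p μ = eLpNorm (fderiv ℝ φ) p μ :=
  eLpNorm_congr_norm_ae <| .of_forall fun x => by rw [gradient, LinearIsometryEquiv.norm_map]

lemma continuous_gradient (hφ : ContDiff ℝ 1 φ) : Continuous (gradient φ) :=
  (InnerProductSpace.toDual ℝ (E N)).symm.continuous.comp (hφ.continuous_fderiv one_ne_zero)

lemma gradient_comp {Ψ : ℝ → ℝ} {x : E N} (hΨ : DifferentiableAt ℝ Ψ (φ x))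
    (hφ : DifferentiableAt ℝ φ x) :
    gradient (fun y => Ψ (φ y)) x = deriv Ψ (φ x) • gradient φ x := by
  have h : fderiv ℝ (fun y => Ψ (φ y)) x = deriv Ψ (φ x) • fderiv ℝ φ x :=
    (hΨ.hasDerivAt.comp_hasFDerivAt x hφ.hasFDerivAt).fderiv
  rw [gradient, h, map_smul, gradient]

lemma hasWeakGradient_gradient (Ω : Set (E N)) (hφ : ContDiff ℝ 1 φ) :
    HasWeakGradient Ω φ (gradient φ) where
  locInt := hφ.continuous.locallyIntegrable.locallyIntegrableOn Ω
  locIntGrad := (continuous_gradient hφ).locallyIntegrable.locallyIntegrableOn Ω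
  eq ψ hψ hψc hψΩ i := by
    have hψ₀ (x : E N) (hx : x ∉ Ω) : ψ x = 0 :=
      image_eq_zero_of_notMem_tsupport fun h => hx (hψΩ h)
    have hdψ₀ (x : E N) (hx : x ∉ Ω) : fderiv ℝ ψ x = 0 :=
      image_eq_zero_of_notMem_tsupport fun h => hx (hψΩ (tsupport_fderiv_subset ℝ h))
    rw [setIntegral_eq_integral_of_forall_compl_eq_zero fun x hx => by simp [hdψ₀ x hx],
      setIntegral_eq_integral_of_forall_compl_eq_zero fun x hx => by simp [hψ₀ x hx]]
    simp only [gradient_apply]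
    have hdψ : Continuous fun x => fderiv ℝ ψ x (EuclideanSpace.single i 1) :=
      (hψ.continuous_fderiv (by simp)).clm_apply continuous_const
    have hdφ : Continuous fun x => fderiv ℝ φ x (EuclideanSpace.single i 1) :=
      (hφ.continuous_fderiv one_ne_zero).clm_apply continuous_const
    refine integral_mul_fderiv_eq_neg_fderiv_mul_of_integrable
      ((hdφ.mul hψ.continuous).integrable_of_hasCompactSupport hψc.mul_left)
      ((hφ.continuous.mul hdψ).integrable_of_hasCompactSupport
        (hψc.fderiv_apply (𝕜 := ℝ) _).mul_left)
      ((hφ.continuous.mul hψ.continuous).integrable_of_hasCompactSupport hψc.mul_left)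
      (fun x _ => hφ.differentiable one_ne_zero x) fun x _ => hψ.differentiable (by simp) x

lemma HasWeakGradient.sub (hu : HasWeakGradient Ω u G) (hv : HasWeakGradient Ω v H) :
    HasWeakGradient Ω (fun x => u x - v x) (fun x => G x - H x) := by
  simpa [sub_eq_add_neg] using hu.add (hv.const_smul (-1))

lemma HasWeakGradient.ae_eq (hΩ : IsOpen Ω) (hG : HasWeakGradient Ω u G)
    (hH : HasWeakGradient Ω u H) : G =ᵐ[volume.restrict Ω] H := by
  have hcoord (i : Fin N) : ∀ᵐ x, x ∈ Ω → G x i - H x i = 0 := by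
    refine hΩ.ae_eq_zero_of_integral_contDiff_smul_eq_zero
      ((locallyIntegrableOn_coord hG.locIntGrad i).sub (locallyIntegrableOn_coord hH.locIntGrad i))
      fun ψ hψ hψc hψΩ => ?_
    rw [← setIntegral_eq_integral_of_forall_compl_eq_zero (s := Ω) fun x hx => by
      rw [image_eq_zero_of_notMem_tsupport fun h => hx (hψΩ h), zero_smul]]
    simp only [smul_eq_mul, mul_comm (ψ _), sub_mul]
    rw [integral_sub (integrable_right hG.locIntGrad hψ hψc hψΩ i)
      (integrable_right hH.locIntGrad hψ hψc hψΩ i)]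
    linarith [hG.eq ψ hψ hψc hψΩ i, hH.eq ψ hψ hψc hψΩ i]
  rw [Filter.EventuallyEq, ae_restrict_iff' hΩ.measurableSet]
  filter_upwards [ae_all_iff.2 hcoord] with x hx hxΩ
  ext i
  exact sub_eq_zero.1 (hx i hxΩ)

lemma MemW1.memLp_of_hasWeakGradient (hΩ : IsOpen Ω) (hu : MemW1 Ω p u)
    (hG : HasWeakGradient Ω u G) : MemLp G p (volume.restrict Ω) := by
  obtain ⟨_, H, hH, hHp⟩ := hu
  exact (memLp_congr_ae (hG.ae_eq hΩ hH)).2 hHp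

lemma eLpNorm_le_sum_coord {μ : Measure (E N)} (hG : AEStronglyMeasurable G μ) (hp : 1 ≤ p) :
    eLpNorm G p μ ≤ ∑ i, eLpNorm (fun x => G x i) p μ := by
  calc eLpNorm G p μ = eLpNorm (∑ i, fun x => G x i • EuclideanSpace.single i (1 : ℝ)) p μ := by
        congr 1
        ext x j
        simp [Pi.single_apply]
    _ ≤ ∑ i, eLpNorm (fun x => G x i • EuclideanSpace.single i (1 : ℝ)) p μ :=
        eLpNorm_sum_le (fun i _ => ((EuclideanSpace.proj i : E N →L[ℝ] ℝ).continuous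
          |>.comp_aestronglyMeasurable hG).smul_const _) hp
    _ = _ := Finset.sum_congr rfl fun i _ => eLpNorm_congr_norm_ae <| .of_forall fun x => by
        simp [norm_smul]

lemma eLpNorm_coord_le {μ : Measure (E N)} (G : E N → E N) (p : ℝ≥0∞) (i : Fin N) :
    eLpNorm (fun x => G x i) p μ ≤ eLpNorm G p μ :=
  eLpNorm_mono fun x => PiLp.norm_apply_le (G x) i

lemma HasWeakGradient.w1Norm_eq (hΩ : IsOpen Ω) (hG : HasWeakGradient Ω u G) (p : ℝ≥0∞) :
    w1Norm Ω p u =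
      eLpNorm u p (volume.restrict Ω) + ∑ i, eLpNorm (fun x => G x i) p (volume.restrict Ω) := by
  refine le_antisymm (iInf₂_le _ hG) (le_iInf₂ fun H hH => ?_)
  refine add_le_add le_rfl (Finset.sum_le_sum fun i _ => le_of_eq (eLpNorm_congr_ae ?_))
  filter_upwards [hG.ae_eq hΩ hH] with x hx
  rw [hx]

lemma HasWeakGradient.eLpNorm_add_eLpNorm_le_w1Norm (hΩ : IsOpen Ω) (hp : 1 ≤ p)
    (hG : HasWeakGradient Ω u G) :
    eLpNorm u p (volume.restrict Ω) + eLpNorm G p (volume.restrict Ω) ≤ w1Norm Ω p u := by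
  grw [hG.w1Norm_eq hΩ, eLpNorm_le_sum_coord hG.locIntGrad.aestronglyMeasurable hp]

lemma HasWeakGradient.w1Norm_le (hG : HasWeakGradient Ω u G) (p : ℝ≥0∞) :
    w1Norm Ω p u ≤ eLpNorm u p (volume.restrict Ω) + N * eLpNorm G p (volume.restrict Ω) := by
  grw [w1Norm, iInf₂_le _ hG, Finset.sum_le_sum fun i _ => eLpNorm_coord_le G p i]
  simp

lemma hasWeakGradient_of_tendsto (hp : 1 ≤ p) {u' : ℕ → E N → ℝ} {G' : ℕ → E N → E N}
    (hG' : ∀ k, HasWeakGradient Ω (u' k) (G' k)) (hu : MemLp u p (volume.restrict Ω))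
    (hG : MemLp G p (volume.restrict Ω))
    (hulim : Tendsto (fun k => eLpNorm (fun x => u' k x - u x) p (volume.restrict Ω)) atTop (𝓝 0))
    (hGlim : Tendsto (fun k => eLpNorm (fun x => G' k x - G x) p (volume.restrict Ω)) atTop
      (𝓝 0)) : HasWeakGradient Ω u G where
  locInt := locallyIntegrableOn_of_locallyIntegrable_restrict (hu.locallyIntegrable hp)
  locIntGrad := locallyIntegrableOn_of_locallyIntegrable_restrict (hG.locallyIntegrable hp)
  eq ψ hψ hψc hψΩ i := by
    have := ENNReal.HolderConjugate.conjExponent hp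
    have hψm : MemLp ψ (ENNReal.conjExponent p) (volume.restrict Ω) :=
      (hψ.continuous.memLp_of_hasCompactSupport hψc).restrict _
    have hdψm : MemLp (fun x => fderiv ℝ ψ x (EuclideanSpace.single i 1)) (ENNReal.conjExponent p)
        (volume.restrict Ω) :=
      (((hψ.continuous_fderiv (by simp)).clm_apply continuous_const).memLp_of_hasCompactSupport
        (hψc.fderiv_apply (𝕜 := ℝ) _)).restrict _
    have hleft := tendsto_integral_mul_of_tendsto_eLpNorm
      (fun k => (hG' k).locInt.aestronglyMeasurable) hu hdψm hulim
    have hright := tendsto_integral_mul_of_tendsto_eLpNorm (f := fun k x => G' k x i)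
      (fun k => (locallyIntegrableOn_coord (hG' k).locIntGrad i).aestronglyMeasurable)
      ((EuclideanSpace.proj i : E N →L[ℝ] ℝ).comp_memLp' hG) hψm
      (tendsto_nhds_bot_mono' hGlim fun k => eLpNorm_coord_le (fun x => G' k x - G x) p i)
    simp only [fun k => (hG' k).eq ψ hψ hψc hψΩ i] at hleft
    exact tendsto_nhds_unique hleft hright.neg

end WeakGradient

section Trace

variable {N : ℕ} {Ω : Set (E N)} {u : E N → ℝ} {G : E N → E N}

/-- The `C¹` functions `φ k` approximate `u`, of weak gradient `G`, in `H¹(Ω)` and almost everywhere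
in `Ω`, and they approximate its trace `g` in `L²(∂Ω)`. -/
structure IsTraceApprox (Ω : Set (E N)) (φ : ℕ → E N → ℝ) (u : E N → ℝ) (G : E N → E N)
    (g : E N → ℝ) : Prop where
  contDiff : ∀ k, ContDiff ℝ 1 (φ k)
  ae_tendsto : ∀ᵐ x ∂(volume.restrict Ω), Tendsto (fun k => φ k x) atTop (𝓝 (u x))
  tendsto : Tendsto (fun k => eLpNorm (fun x => φ k x - u x) 2 (volume.restrict Ω)) atTop (𝓝 0)
  tendsto_gradient : Tendsto (fun k => eLpNorm (fun x => gradient (φ k) x - G x) 2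
    (volume.restrict Ω)) atTop (𝓝 0)
  tendsto_trace : Tendsto (fun k => eLpNorm (fun x => φ k x - g x) 2 (surf Ω)) atTop (𝓝 0)

lemma HasTrace.exists_isTraceApprox (hΩ : IsOpen Ω) {g : Lp ℝ 2 (surf Ω)} (hu : HasTrace Ω u g)
    (hG : HasWeakGradient Ω u G) : ∃ φ, IsTraceApprox Ω φ u G g := by
  obtain ⟨hu₂, φ, hφ, hφu, hφg⟩ := hu
  have hle (k : ℕ) := ((hasWeakGradient_gradient Ω (hφ k)).sub hG).eLpNorm_add_eLpNorm_le_w1Norm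
    hΩ (p := 2) (by norm_num)
  have hlim : Tendsto (fun k => eLpNorm (fun x => φ k x - u x) 2 (volume.restrict Ω)) atTop
      (𝓝 0) := tendsto_nhds_bot_mono' hφu fun k => le_self_add.trans (hle k)
  obtain ⟨n, hn, hae⟩ := (tendstoInMeasure_of_tendsto_eLpNorm (p := 2) (by norm_num)
    (fun k => (hφ k).continuous.aestronglyMeasurable) hu₂.1.1 hlim).exists_seq_tendsto_ae
  exact ⟨fun k => φ (n k), fun k => hφ (n k), hae, hlim.comp hn.tendsto_atTop,
    (tendsto_nhds_bot_mono' hφu fun k => le_add_self.trans (hle k)).comp hn.tendsto_atTop,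
    hφg.comp hn.tendsto_atTop⟩

namespace IsTraceApprox

variable {φ : ℕ → E N → ℝ} {g : E N → ℝ}

lemma congr_trace (h : IsTraceApprox Ω φ u G g) {g' : E N → ℝ} (hg : g' =ᵐ[surf Ω] g) :
    IsTraceApprox Ω φ u G g' where
  __ := h
  tendsto_trace := h.tendsto_trace.congr fun k => eLpNorm_congr_ae <| by
    filter_upwards [hg] with x hx
    rw [hx]

lemma hasWeakGradient (h : IsTraceApprox Ω φ u G g) (hu : MemLp u 2 (volume.restrict Ω))
    (hG : MemLp G 2 (volume.restrict Ω)) : HasWeakGradient Ω u G :=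
  hasWeakGradient_of_tendsto (by norm_num) (fun k => hasWeakGradient_gradient Ω (h.contDiff k))
    hu hG h.tendsto h.tendsto_gradient

lemma hasTrace {g : Lp ℝ 2 (surf Ω)} (h : IsTraceApprox Ω φ u G g)
    (hu : MemLp u 2 (volume.restrict Ω)) (hG : MemLp G 2 (volume.restrict Ω)) :
    HasTrace Ω u g := by
  have hw := h.hasWeakGradient hu hG
  have hlim := h.tendsto.add <|
    ENNReal.Tendsto.const_mul h.tendsto_gradient (.inr (ENNReal.natCast_ne_top N))
  rw [mul_zero, add_zero] at hlim
  exact ⟨⟨hu, G, hw, hG⟩, φ, h.contDiff, tendsto_nhds_bot_mono' hlim fun k =>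
    ((hasWeakGradient_gradient Ω (h.contDiff k)).sub hw).w1Norm_le 2, h.tendsto_trace⟩

lemma comp (h : IsTraceApprox Ω φ u G g) (hu : AEStronglyMeasurable u (volume.restrict Ω))
    (hG : MemLp G 2 (volume.restrict Ω)) {Ψ : ℝ → ℝ} {M : ℝ≥0} (hΨ : ContDiff ℝ 1 Ψ)
    (hΨM : LipschitzWith M Ψ) :
    IsTraceApprox Ω (fun k x => Ψ (φ k x)) (fun x => Ψ (u x)) (fun x => deriv Ψ (u x) • G x)
      fun x => Ψ (g x) where
  contDiff k := hΨ.comp (h.contDiff k)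
  ae_tendsto := h.ae_tendsto.mono fun x hx => (hΨ.continuous.tendsto (u x)).comp hx
  tendsto := tendsto_eLpNorm_comp_sub_comp hΨM h.tendsto
  tendsto_trace := tendsto_eLpNorm_comp_sub_comp hΨM h.tendsto_trace
  tendsto_gradient := by
    have hΨ' : Continuous (deriv Ψ) := hΨ.continuous_deriv le_rfl
    simp only [fun k x => gradient_comp (hΨ.differentiable one_ne_zero (φ k x))
      ((h.contDiff k).differentiable one_ne_zero x)]
    exact tendsto_eLpNorm_smul_sub_smul (by norm_num) (by norm_num)
      (fun k => (hΨ'.comp (h.contDiff k).continuous).aestronglyMeasurable)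
      (hΨ'.comp_aestronglyMeasurable hu)
      (fun k => (continuous_gradient (h.contDiff k)).aestronglyMeasurable) hG
      (fun k x => norm_deriv_le_of_lipschitz hΨM) (fun x => norm_deriv_le_of_lipschitz hΨM)
      (h.ae_tendsto.mono fun x hx => (hΨ'.tendsto (u x)).comp hx) h.tendsto_gradient

end IsTraceApprox

theorem HasTrace.comp (hΩ : IsOpen Ω) {g : Lp ℝ 2 (surf Ω)} (hu : HasTrace Ω u g)
    (hG : HasWeakGradient Ω u G) {Ψ : ℝ → ℝ} {M : ℝ≥0} (hΨ : ContDiff ℝ 1 Ψ)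
    (hΨM : LipschitzWith M Ψ) (hΨ₀ : Ψ 0 = 0) :
    HasTrace Ω (fun x => Ψ (u x)) (hΨM.compLp hΨ₀ g) ∧
      HasWeakGradient Ω (fun x => Ψ (u x)) (fun x => deriv Ψ (u x) • G x) := by
  obtain ⟨φ, hφ⟩ := hu.exists_isTraceApprox hΩ hG
  have hu₂ := hu.1.1
  have hG₂ := hu.1.memLp_of_hasWeakGradient hΩ hG
  have hΨu : MemLp (fun x => Ψ (u x)) 2 (volume.restrict Ω) := hΨM.comp_memLp hΨ₀ hu₂
  have hΨG : MemLp (fun x => deriv Ψ (u x) • G x) 2 (volume.restrict Ω) :=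
    hG₂.of_le_mul (c := M) (((hΨ.continuous_deriv le_rfl).comp_aestronglyMeasurable hu₂.1).smul
      hG₂.1) <| .of_forall fun x => by grw [norm_smul, norm_deriv_le_of_lipschitz hΨM]
  have hΨφ := (hφ.comp hu₂.1 hG₂ hΨ hΨM).congr_trace (hΨM.coeFn_compLp hΨ₀ g)
  exact ⟨hΨφ.hasTrace hΨu hΨG, hΨφ.hasWeakGradient hΨu hΨG⟩

theorem IsBoundedLipschitzDomain.exists_eLpNorm_le_of_trace_eq_zero (hN : 1 ≤ N)
    (hΩ : IsBoundedLipschitzDomain Ω) {p : ℝ} (hp : 2 ≤ p) (hpN : 1 / 2 - 1 / (N : ℝ) < 1 / p)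
    {S : Set (E N)} (hS : surf Ω S ≠ 0) :
    ∃ C : ℝ≥0, ∀ (w : E N → ℝ) (W : E N → E N) (g : Lp ℝ 2 (surf Ω)), HasTrace Ω w g →
      HasWeakGradient Ω w W → g =ᵐ[(surf Ω).restrict S] 0 →
        eLpNorm w (.ofReal p) (volume.restrict Ω) ≤ C * eLpNorm W 2 (volume.restrict Ω) := by
  have := hΩ.isFiniteMeasure_surf hN
  obtain ⟨C, hC⟩ := hΩ.dominatedOnC1_eLpNorm hN one_le_two hp hpN hS
  refine ⟨C, fun w W g hw hW hg => ?_⟩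
  obtain ⟨φ, hφ⟩ := hw.exists_isTraceApprox hΩ.isOpen hW
  have hWm := hW.locIntGrad.aestronglyMeasurable
  have hgrad (k : ℕ) : eLpNorm (fderiv ℝ (φ k)) 2 (volume.restrict Ω) ≤
      eLpNorm (fun x => gradient (φ k) x - W x) 2 (volume.restrict Ω) +
        eLpNorm W 2 (volume.restrict Ω) := by
    have hφm := (continuous_gradient (hφ.contDiff k)).aestronglyMeasurable
      (μ := volume.restrict Ω)
    rw [← eLpNorm_gradient]
    exact (eLpNorm_congr_ae (.of_forall fun x => (sub_add_cancel _ (W x)).symm)).trans_le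
      (eLpNorm_add_le (hφm.sub hWm) hWm one_le_two)
  have hlim := ENNReal.Tendsto.const_mul ((ENNReal.Tendsto.mul_const hφ.tendsto_trace
    (.inr (by finiteness : surf Ω S ^ (1 / 2 : ℝ) ≠ ⊤))).add (hφ.tendsto_gradient.add_const
      (eLpNorm W 2 (volume.restrict Ω)))) (.inr (ENNReal.coe_ne_top (r := C)))
  rw [zero_mul, zero_add, zero_add] at hlim
  refine (Lp.eLpNorm_lim_le_liminf_eLpNorm
    (fun k => (hφ.contDiff k).continuous.aestronglyMeasurable) w hφ.ae_tendsto).trans ?_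
  rw [← hlim.liminf_eq]
  refine liminf_le_liminf (.of_forall fun k => (hC (φ k) (hφ.contDiff k)).trans ?_)
  have htrace := eLpNorm_one_restrict_le_of_ae_eq_zero
    (hφ.contDiff k).continuous.aestronglyMeasurable (Lp.aestronglyMeasurable g) hg
  simpa using mul_le_mul_right (add_le_add htrace (hgrad k)) (C : ℝ≥0∞)

end Trace

section BoundedVariation

open scoped BoundedContinuousFunction

variable {α : Type*} [MeasurableSpace α] {ν : Measure α} {f : α → ℝ}

lemma eLpNorm_one_withDensity_enorm {h : α → ℝ} (hf : AEStronglyMeasurable f ν)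
    (hh : AEStronglyMeasurable h ν) :
    eLpNorm h 1 (ν.withDensity fun x => ‖f x‖ₑ) = eLpNorm (fun x => h x * f x) 1 ν := by
  rw [eLpNorm_one_eq_lintegral_enorm, eLpNorm_one_eq_lintegral_enorm,
    lintegral_withDensity_eq_lintegral_mul₀ hf.enorm hh.enorm]
  simp only [Pi.mul_apply, enorm_mul, mul_comm]

variable [TopologicalSpace α] [BorelSpace α]

lemma integrable_boundedContinuous_mul (hf : Integrable f ν) (g : α →ᵇ ℝ) :
    Integrable (fun x => g x * f x) ν :=
  hf.bdd_mul g.continuous.measurable.aestronglyMeasurable (.of_forall g.norm_coe_le_norm)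

/-- The functional `g ↦ ∫ g f dν` on bounded continuous functions, that is, the finite signed
measure of density `f`. -/
def densityFunctional (hf : Integrable f ν) : (α →ᵇ ℝ) →L[ℝ] ℝ :=
  LinearMap.mkContinuous
    { toFun := fun g => ∫ x, g x * f x ∂ν
      map_add' := fun g g' => by
        rw [← integral_add (integrable_boundedContinuous_mul hf g)
          (integrable_boundedContinuous_mul hf g')]
        simp [add_mul]
      map_smul' := fun c g => by
        rw [RingHom.id_apply, smul_eq_mul, ← integral_const_mul]
        simp [mul_assoc] }
    (∫ x, ‖f x‖ ∂ν) fun g => by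
      rw [mul_comm, ← integral_const_mul]
      refine norm_integral_le_of_norm_le (hf.norm.const_mul _) (.of_forall fun x => ?_)
      grw [norm_mul, g.norm_coe_le_norm x]

lemma densityFunctional_apply (hf : Integrable f ν) (g : α →ᵇ ℝ) :
    densityFunctional hf g = ∫ x, g x * f x ∂ν := rfl

lemma exists_boundedContinuous_norm_le_one_eLpNorm_sub_le [NormalSpace α] [ν.WeaklyRegular]
    {s : α → ℝ} (hs : MemLp s 1 ν) (hs₁ : ∀ x, |s x| ≤ 1) {ε : ℝ≥0∞} (hε : ε ≠ 0) :
    ∃ g : α →ᵇ ℝ, ‖g‖ ≤ 1 ∧ eLpNorm (fun x => s x - g x) 1 ν ≤ ε := by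
  obtain ⟨g, hg, -⟩ := hs.exists_boundedContinuous_eLpNorm_sub_le (by simp) hε
  let clip (t : ℝ) : ℝ := projIcc (-1) 1 (by norm_num) t
  have hclip : LipschitzWith 1 clip := LipschitzWith.projIcc (by norm_num : (-1 : ℝ) ≤ 1)
  have hclip₁ (t : ℝ) : ‖clip t‖ ≤ 1 := abs_le.2 (projIcc (-1) 1 (by norm_num) t).2
  let g' : α →ᵇ ℝ := .ofNormedAddCommGroup (fun x => clip (g x))
    (hclip.continuous.comp g.continuous) 1 fun x => hclip₁ (g x)
  refine ⟨g', BoundedContinuousFunction.norm_ofNormedAddCommGroup_le _ zero_le_one _,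
    (eLpNorm_mono fun x => ?_).trans hg⟩
  have hsx : clip (s x) = s x := by simp only [clip, projIcc_of_mem _ (abs_le.1 (hs₁ x))]
  simpa [g', hsx, dist_eq_norm] using hclip.dist_le_mul (s x) (g x)

lemma exists_boundedContinuous_eLpNorm_abs_sub_mul_le [TopologicalSpace.PseudoMetrizableSpace α]
    (hf : Integrable f ν) {ε : ℝ≥0∞} (hε : ε ≠ 0) :
    ∃ g : α →ᵇ ℝ, ‖g‖ ≤ 1 ∧ eLpNorm (fun x => |f x| - g x * f x) 1 ν ≤ ε := by
  let s (x : α) : ℝ := f x / |f x|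
  have hsf (x : α) : s x * f x = |f x| := by
    rw [div_mul_eq_mul_div, ← abs_mul_abs_self, mul_self_div_self]
  have hs : AEStronglyMeasurable s ν :=
    (hf.aemeasurable.div hf.aemeasurable.norm).aestronglyMeasurable
  have hs₁ (x : α) : |s x| ≤ 1 := by simpa [s, abs_div] using div_self_le_one |f x|
  -- For the finite measure `|f| dν`, approximating `s` in `L¹` amounts to approximating `s f`.
  have := isFiniteMeasure_withDensity hf.2.ne
  have hs' : MemLp s 1 (ν.withDensity fun x => ‖f x‖ₑ) :=
    .of_bound (hs.mono_ac (withDensity_absolutelyContinuous _ _)) 1 (.of_forall hs₁)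
  obtain ⟨g, hg₁, hg⟩ := exists_boundedContinuous_norm_le_one_eLpNorm_sub_le hs' hs₁ hε
  refine ⟨g, hg₁, hg.trans' (le_of_eq ?_)⟩
  have hsub : AEStronglyMeasurable (fun x => s x - g x) ν :=
    hs.sub g.continuous.measurable.aestronglyMeasurable
  rw [eLpNorm_one_withDensity_enorm hf.1 hsub]
  simp only [sub_mul, hsf]

lemma eLpNorm_one_le_enorm_densityFunctional [TopologicalSpace.PseudoMetrizableSpace α]
    (hf : Integrable f ν) : eLpNorm f 1 ν ≤ ‖densityFunctional hf‖ₑ := by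
  refine ENNReal.le_of_forall_pos_le_add fun ε hε _ => ?_
  obtain ⟨g, hg₁, hg⟩ := exists_boundedContinuous_eLpNorm_abs_sub_mul_le hf
    (ENNReal.coe_ne_zero.2 hε.ne')
  have hgf := integrable_boundedContinuous_mul hf g
  have hadd : ∫ x, |f x| ∂ν = densityFunctional hf g + ∫ x, (|f x| - g x * f x) ∂ν := by
    rw [densityFunctional_apply, integral_sub hf.abs hgf, add_sub_cancel]
  calc eLpNorm f 1 ν = ‖∫ x, |f x| ∂ν‖ₑ := by
        rw [eLpNorm_one_eq_lintegral_enorm, ← ofReal_integral_norm_eq_lintegral_enorm hf,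
          Real.enorm_of_nonneg (integral_nonneg fun x => abs_nonneg _)]
        rfl
    _ ≤ ‖densityFunctional hf‖ₑ * ‖g‖ₑ + eLpNorm (fun x => |f x| - g x * f x) 1 ν := by
        rw [hadd, eLpNorm_one_eq_lintegral_enorm]
        grw [enorm_add_le, ContinuousLinearMap.le_opENorm, enorm_integral_le_lintegral_enorm]
    _ ≤ ‖densityFunctional hf‖ₑ + ε := by
        grw [hg, show ‖g‖ₑ ≤ 1 by simpa [← ofReal_norm] using hg₁, mul_one]

theorem WeakStarTendsto.boundedVariation {N : ℕ} {Ω : Set (E N)} {μ : ℕ → E N → ℝ}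
    (hμ : ∀ n, Integrable (μ n) (volume.restrict Ω)) {ν : SignedMeasure (E N)}
    (h : WeakStarTendsto Ω μ ν) : BoundedVariation Ω μ := by
  obtain ⟨C, hC⟩ := banach_steinhaus (g := fun n => densityFunctional (hμ n)) fun g => by
    obtain ⟨C, hC⟩ := (Metric.isBounded_range_of_tendsto _
      (h g g.continuous.continuousOn)).exists_norm_le
    exact ⟨C, fun n => hC _ ⟨n, rfl⟩⟩
  refine ⟨C.toNNReal, fun n => (eLpNorm_one_le_enorm_densityFunctional (hμ n)).trans ?_⟩
  rw [← ofReal_norm]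
  exact ENNReal.ofReal_le_ofReal (hC n)

end BoundedVariation

section BracketPrim

/-- The primitive of `(1 + t²)^(-a)` vanishing at `0`. It is bounded for `a > 1/2`. -/
def bracketPrim (a s : ℝ) : ℝ := ∫ t in (0 : ℝ)..s, (1 + t ^ 2) ^ (-a)

lemma continuous_bracket (a : ℝ) : Continuous fun t : ℝ => (1 + t ^ 2) ^ a :=
  Continuous.rpow_const (by fun_prop) fun t => .inl (by positivity)

lemma bracketPrim_zero (a : ℝ) : bracketPrim a 0 = 0 :=
  intervalIntegral.integral_same

lemma hasDerivAt_bracketPrim (a s : ℝ) : HasDerivAt (bracketPrim a) ((1 + s ^ 2) ^ (-a)) s :=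
  (continuous_bracket _).integral_hasStrictDerivAt 0 s |>.hasDerivAt

lemma deriv_bracketPrim (a s : ℝ) : deriv (bracketPrim a) s = (1 + s ^ 2) ^ (-a) :=
  (hasDerivAt_bracketPrim a s).deriv

lemma contDiff_bracketPrim (a : ℝ) : ContDiff ℝ 1 (bracketPrim a) := by
  rw [contDiff_one_iff_deriv, funext (deriv_bracketPrim a)]
  exact ⟨fun s => (hasDerivAt_bracketPrim a s).differentiableAt, continuous_bracket _⟩

lemma lipschitzWith_bracketPrim {a : ℝ} (ha : 0 ≤ a) : LipschitzWith 1 (bracketPrim a) := by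
  refine lipschitzWith_of_nnnorm_deriv_le
    (fun s => (hasDerivAt_bracketPrim a s).differentiableAt) fun s => ?_
  rw [deriv_bracketPrim, ← NNReal.coe_le_coe, coe_nnnorm, Real.norm_of_nonneg (by positivity)]
  exact Real.rpow_le_one_of_one_le_of_nonpos (by nlinarith [sq_nonneg s]) (by linarith)

lemma exists_abs_bracketPrim_le {a : ℝ} (ha : 1 / 2 < a) :
    ∃ M : ℝ≥0, ∀ s, |bracketPrim a s| ≤ M := by
  have hint : Integrable fun t : ℝ => (1 + t ^ 2) ^ (-a) := by
    have h := integrable_rpow_neg_one_add_norm_sq (E := ℝ) (μ := volume) (r := 2 * a)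
      (by simp; linarith)
    simpa [show -(2 * a) / 2 = -a by ring] using h
  refine ⟨(∫ t : ℝ, ‖(1 + t ^ 2) ^ (-a)‖).toNNReal, fun s => ?_⟩
  rw [Real.coe_toNNReal _ (integral_nonneg fun _ => norm_nonneg _), ← Real.norm_eq_abs]
  exact intervalIntegral.norm_integral_le_integral_norm_uIoc.trans
    (setIntegral_le_integral hint.norm (.of_forall fun _ => norm_nonneg _))

lemma bracketPrim_neg (a s : ℝ) : bracketPrim a (-s) = -bracketPrim a s := by
  have h := intervalIntegral.integral_comp_neg (a := s) (b := 0) fun t => (1 + t ^ 2) ^ (-a)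
  simp only [neg_sq, neg_zero] at h
  rw [bracketPrim, bracketPrim, ← h, intervalIntegral.integral_symm]

lemma abs_mul_le_abs_bracketPrim {a : ℝ} (ha : 0 ≤ a) (s : ℝ) :
    |s| * (1 + s ^ 2) ^ (-a) ≤ |bracketPrim a s| := by
  wlog hs : 0 ≤ s
  · simpa [bracketPrim_neg] using this ha (-s) (by linarith)
  have hmono := intervalIntegral.integral_mono_on (μ := volume)
    (f := fun _ => (1 + s ^ 2) ^ (-a)) (g := fun t => (1 + t ^ 2) ^ (-a)) hs
    (continuous_const.intervalIntegrable _ _) ((continuous_bracket _).intervalIntegrable _ _)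
    fun t ht => Real.rpow_le_rpow_of_nonpos (by positivity) (by nlinarith [ht.1, ht.2])
      (by linarith)
  rw [abs_of_nonneg hs]
  exact le_trans (by simpa [bracketPrim] using hmono) (le_abs_self _)

lemma bracket_rpow_le {β κ : ℝ} (hβ : 0 ≤ β) (hκ : 0 ≤ κ) (hβκ : (1 / 2 - β) * κ = β) (s : ℝ) :
    (1 + s ^ 2) ^ β ≤ 2 ^ β + √2 ^ κ * |bracketPrim β s| ^ κ := by
  rcases le_total (s ^ 2) 1 with hs | hs
  · have hle : (1 + s ^ 2) ^ β ≤ 2 ^ β := Real.rpow_le_rpow (by positivity) (by linarith) hβ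
    have hnonneg : 0 ≤ √2 ^ κ * |bracketPrim β s| ^ κ := by positivity
    linarith
  have hpos : 0 < 1 + s ^ 2 := by positivity
  have hsqrt : √(1 + s ^ 2) ≤ √2 * |s| := by
    rw [← Real.sqrt_sq_eq_abs, ← Real.sqrt_mul (by norm_num)]
    exact Real.sqrt_le_sqrt (by linarith)
  have hbase : (1 + s ^ 2) ^ (1 / 2 - β) ≤ √2 * |bracketPrim β s| := by
    rw [sub_eq_add_neg, Real.rpow_add hpos, ← Real.sqrt_eq_rpow]
    grw [hsqrt, mul_assoc, abs_mul_le_abs_bracketPrim hβ s]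
  calc (1 + s ^ 2) ^ β = ((1 + s ^ 2) ^ (1 / 2 - β)) ^ κ := by rw [← Real.rpow_mul hpos.le, hβκ]
    _ ≤ (√2 * |bracketPrim β s|) ^ κ := Real.rpow_le_rpow (by positivity) hbase hκ
    _ = √2 ^ κ * |bracketPrim β s| ^ κ := Real.mul_rpow (by positivity) (by positivity)
    _ ≤ _ := le_add_of_nonneg_left (by positivity)

end BracketPrim

section WeightedEstimates

variable {α : Type*} [MeasurableSpace α] {μ : Measure α} {z : α → ℝ} {β : ℝ}

lemma eLpNorm_bracket_le {κ : ℝ} (hz : AEStronglyMeasurable z μ) (hβ : 0 ≤ β) (hκ : 0 < κ)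
    (hβκ : (1 / 2 - β) * κ = β) {m : ℝ} (hm : 1 ≤ m) :
    eLpNorm (fun x => (1 + z x ^ 2) ^ β) (.ofReal m) μ ≤
      .ofReal (2 ^ β) * μ univ ^ (1 / m) +
        .ofReal (√2 ^ κ) * eLpNorm (fun x => bracketPrim β (z x)) (.ofReal (m * κ)) μ ^ κ := by
  have hm₀ : 0 < m := by linarith
  set w : α → ℝ := fun x => bracketPrim β (z x)
  have hw : AEStronglyMeasurable w μ :=
    (contDiff_bracketPrim β).continuous.comp_aestronglyMeasurable hz
  have hwκ : AEStronglyMeasurable (fun x => ‖w x‖ ^ κ) μ :=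
    (hw.norm.aemeasurable.pow_const κ).aestronglyMeasurable
  calc eLpNorm (fun x => (1 + z x ^ 2) ^ β) (.ofReal m) μ
      ≤ eLpNorm ((fun _ => (2 : ℝ) ^ β) + √2 ^ κ • fun x => ‖w x‖ ^ κ) (.ofReal m) μ :=
        eLpNorm_mono_real fun x => by
          rw [Real.norm_of_nonneg (by positivity)]
          exact bracket_rpow_le hβ hκ.le hβκ (z x)
    _ ≤ eLpNorm (fun _ => (2 : ℝ) ^ β) (.ofReal m) μ +
          eLpNorm (√2 ^ κ • fun x => ‖w x‖ ^ κ) (.ofReal m) μ :=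
        eLpNorm_add_le aestronglyMeasurable_const (hwκ.const_smul _) (ENNReal.one_le_ofReal.2 hm)
    _ = _ := by
        rw [eLpNorm_const' _ (by simpa) ENNReal.ofReal_ne_top, eLpNorm_const_smul,
          eLpNorm_norm_rpow w hκ, Real.enorm_of_nonneg (by positivity),
          Real.enorm_of_nonneg (by positivity), ENNReal.toReal_ofReal hm₀.le,
          ENNReal.ofReal_mul hm₀.le]

lemma eLpNorm_le_eLpNorm_bracket (hz : AEStronglyMeasurable z μ) (hβ : 0 < β) {q m : ℝ}
    (hq : 0 ≤ q) (hm : q / (2 * β) ≤ m) :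
    eLpNorm z (.ofReal q) μ ≤ (eLpNorm (fun x => (1 + z x ^ 2) ^ β) (.ofReal m) μ *
      μ univ ^ (1 / (q / (2 * β)) - 1 / m)) ^ (1 / (2 * β)) := by
  have hq' : 0 ≤ q / (2 * β) := by positivity
  calc eLpNorm z (.ofReal q) μ
      ≤ eLpNorm (fun x => ‖(1 + z x ^ 2) ^ β‖ ^ (1 / (2 * β))) (.ofReal q) μ :=
        eLpNorm_mono_real fun x => by
          have hnorm : ‖(1 + z x ^ 2) ^ β‖ = (1 + z x ^ 2) ^ β :=
            Real.norm_of_nonneg (by positivity)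
          rw [hnorm, ← Real.rpow_mul (by positivity),
            show β * (1 / (2 * β)) = 1 / 2 by field_simp, ← Real.sqrt_eq_rpow, Real.norm_eq_abs]
          exact Real.abs_le_sqrt (by linarith)
    _ = eLpNorm (fun x => (1 + z x ^ 2) ^ β) (.ofReal (q / (2 * β))) μ ^ (1 / (2 * β)) := by
        rw [eLpNorm_norm_rpow _ (by positivity), ← ENNReal.ofReal_mul hq, mul_one_div]
    _ ≤ _ := by
        gcongr
        have := eLpNorm_le_eLpNorm_mul_rpow_measure_univ (ENNReal.ofReal_le_ofReal hm)
          ((continuous_bracket β).comp_aestronglyMeasurable hz)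
        rwa [ENNReal.toReal_ofReal hq', ENNReal.toReal_ofReal (hq'.trans hm)] at this

lemma eLpNorm_le_eLpNorm_bracket_mul {F : Type*} [NormedAddCommGroup F] [NormedSpace ℝ F]
    {Z : α → F} (hz : AEStronglyMeasurable z μ) (hZ : AEStronglyMeasurable Z μ)
    {p q r : ℝ≥0∞} [ENNReal.HolderTriple p q r] :
    eLpNorm Z r μ ≤ eLpNorm (fun x => (1 + z x ^ 2) ^ β) p μ *
      eLpNorm (fun x => (1 + z x ^ 2) ^ (-β) • Z x) q μ := by
  have hbracket (b : ℝ) : AEStronglyMeasurable (fun x => (1 + z x ^ 2) ^ b) μ :=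
    (continuous_bracket b).comp_aestronglyMeasurable hz
  have hsmul : Z = (fun x => (1 + z x ^ 2) ^ β) • fun x => (1 + z x ^ 2) ^ (-β) • Z x := by
    ext x
    rw [Pi.smul_apply', smul_smul, ← Real.rpow_add (by positivity), add_neg_cancel,
      Real.rpow_zero, one_smul]
  conv_lhs => rw [hsmul]
  exact eLpNorm_smul_le_mul_eLpNorm ((hbracket _).smul hZ) (hbracket _)

end WeightedEstimates

section Energy

variable {N : ℕ} {Ω Γ₁ Γ₂ : Set (E N)} {u u' ρ ρ' : E N → ℝ}

instance : Zero (HNegHalf Ω Γ₂) :=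
  ⟨⟨0, 0, by simp⟩⟩

lemma HNegHalf.toLinearMap_zero : (0 : HNegHalf Ω Γ₂).toLinearMap = 0 :=
  rfl

lemma integrable_inner_of_memLp_two {α F : Type*} [MeasurableSpace α] [NormedAddCommGroup F]
    [InnerProductSpace ℝ F] {μ : Measure α} {f g : α → F} (hf : MemLp f 2 μ) (hg : MemLp g 2 μ) :
    Integrable (fun x => inner ℝ (f x) (g x)) μ :=
  (hf.norm.integrable_mul hg.norm).mono' (hf.aestronglyMeasurable.inner hg.aestronglyMeasurable)
    (.of_forall fun x => norm_inner_le_norm (f x) (g x))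

lemma MemW1.sub {p : ℝ≥0∞} (hu : MemW1 Ω p u) (hu' : MemW1 Ω p u') :
    MemW1 Ω p (fun x => u x - u' x) := by
  simpa [sub_eq_add_neg] using hu.add (hu'.const_mul (-1))

lemma HasTrace.sub {g g' : Lp ℝ 2 (surf Ω)} (hu : HasTrace Ω u g) (hu' : HasTrace Ω u' g') :
    HasTrace Ω (fun x => u x - u' x) (g - g') := by
  simpa [sub_eq_add_neg] using hu.add (hu'.const_smul (-1))

theorem IsMixedSolution.sub (hΩ : IsOpen Ω) {f₁ : E N → ℝ} {f₂ : HNegHalf Ω Γ₂}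
    (hu : IsMixedSolution Ω Γ₁ Γ₂ ρ f₁ f₂ u) (hu' : IsMixedSolution Ω Γ₁ Γ₂ ρ' f₁ f₂ u')
    (hρ : MemLp ρ 2 (volume.restrict Ω)) (hρ' : MemLp ρ' 2 (volume.restrict Ω)) :
    IsMixedSolution Ω Γ₁ Γ₂ (fun x => ρ x - ρ' x) 0 0 (fun x => u x - u' x) := by
  obtain ⟨g, hg, hgf⟩ := hu.dirichlet
  obtain ⟨g', hg', hgf'⟩ := hu'.dirichlet
  obtain ⟨G, hG, hGreen⟩ := hu.weak
  obtain ⟨G', hG', hGreen'⟩ := hu'.weak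
  have hG₂ := hu.memH1.memLp_of_hasWeakGradient hΩ hG
  have hG₂' := hu'.memH1.memLp_of_hasWeakGradient hΩ hG'
  refine ⟨hu.memH1.sub hu'.memH1, ⟨g - g', hg.sub hg', ?_⟩, _, hG.sub hG', fun v H h hH hv => ?_⟩
  · filter_upwards [ae_restrict_of_ae (Lp.coeFn_sub g g'), hgf, hgf'] with x hsub hx hx'
    rw [hsub, Pi.sub_apply, hx, hx', sub_self, Pi.zero_apply]
  · have hH₂ := hv.1.memLp_of_hasWeakGradient hΩ hH
    have hvρ : Integrable (fun x => v x * ρ x) (volume.restrict Ω) := hv.1.1.integrable_mul hρ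
    have hvρ' : Integrable (fun x => v x * ρ' x) (volume.restrict Ω) := hv.1.1.integrable_mul hρ'
    simp only [inner_sub_left, mul_sub]
    rw [integral_sub (integrable_inner_of_memLp_two hG₂ hH₂)
        (integrable_inner_of_memLp_two hG₂' hH₂),
      integral_sub hvρ hvρ', hGreen v H h hH hv, hGreen' v H h hH hv,
      HNegHalf.toLinearMap_zero, LinearMap.zero_apply]
    ring

lemma compLp_ae_eq_zero {α : Type*} [MeasurableSpace α] {μ : Measure α} {S : Set α}
    {Ψ : ℝ → ℝ} {L : ℝ≥0} (hΨ : LipschitzWith L Ψ) (hΨ₀ : Ψ 0 = 0) {p : ℝ≥0∞} {g : Lp ℝ p μ}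
    (hg : g =ᵐ[μ.restrict S] 0) : hΨ.compLp hΨ₀ g =ᵐ[μ.restrict S] 0 := by
  filter_upwards [ae_restrict_of_ae (hΨ.coeFn_compLp hΨ₀ g), hg] with x hx hgx
  rw [hx, Function.comp_apply, hgx, Pi.zero_apply, hΨ₀]

lemma HasTrace.mem_hTildeHalf (hΓ : frontier Ω \ closure Γ₂ ⊆ Γ₁) {g : Lp ℝ 2 (surf Ω)}
    (hu : HasTrace Ω u g) (hg : g =ᵐ[(surf Ω).restrict Γ₁] 0) : g ∈ HTildeHalf Ω Γ₂ := by
  refine ⟨⟨u, hu⟩, ?_⟩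
  have hmeas : MeasurableSet (frontier Ω \ closure Γ₂) :=
    isClosed_frontier.measurableSet.diff isClosed_closure.measurableSet
  have hg' := (ae_restrict_iff' hmeas).1
    (hg.filter_mono (ae_mono (Measure.restrict_mono hΓ le_rfl)))
  filter_upwards [hg', ae_restrict_mem isClosed_frontier.measurableSet] with x hx hxΩ hxΓ
  exact hx ⟨hxΩ, hxΓ⟩

variable {z : E N → ℝ} {Z : E N → E N}

theorem IsMixedSolution.integral_deriv_mul_sq_le (hΩ : IsOpen Ω)
    (hΓ : frontier Ω \ closure Γ₂ ⊆ Γ₁) (hz : IsMixedSolution Ω Γ₁ Γ₂ ρ 0 0 z)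
    (hZ : HasWeakGradient Ω z Z) (hρ : Integrable ρ (volume.restrict Ω)) {Ψ : ℝ → ℝ} {L M : ℝ≥0}
    (hΨ : ContDiff ℝ 1 Ψ) (hΨL : LipschitzWith L Ψ) (hΨ₀ : Ψ 0 = 0) (hΨM : ∀ s, |Ψ s| ≤ M) :
    ∫ x in Ω, deriv Ψ (z x) * ‖Z x‖ ^ 2 ≤ M * ∫ x in Ω, ‖ρ x‖ := by
  obtain ⟨g, hg, hg₀⟩ := hz.dirichlet
  obtain ⟨G, hG, hGreen⟩ := hz.weak
  obtain ⟨htrace, hgrad⟩ := hg.comp hΩ hZ hΨ hΨL hΨ₀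
  have hmem := htrace.mem_hTildeHalf hΓ (compLp_ae_eq_zero hΨL hΨ₀ hg₀)
  calc ∫ x in Ω, deriv Ψ (z x) * ‖Z x‖ ^ 2
      = ∫ x in Ω, inner ℝ (G x) (deriv Ψ (z x) • Z x) := by
        refine integral_congr_ae ?_
        filter_upwards [hG.ae_eq hΩ hZ] with x hx
        rw [hx, inner_smul_right, real_inner_self_eq_norm_sq]
    _ = ∫ x in Ω, Ψ (z x) * ρ x := by
        rw [hGreen _ _ ⟨_, hmem⟩ hgrad htrace, HNegHalf.toLinearMap_zero, LinearMap.zero_apply,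
          add_zero]
    _ ≤ ∫ x in Ω, M * ‖ρ x‖ := by
        refine (Real.le_norm_self _).trans (norm_integral_le_of_norm_le (hρ.norm.const_mul _)
          (.of_forall fun x => ?_))
        rw [norm_mul, Real.norm_eq_abs (Ψ _)]
        gcongr
        exact hΨM _
    _ = M * ∫ x in Ω, ‖ρ x‖ := integral_const_mul _ _

lemma sq_eLpNorm_two_eq_ofReal_integral {α F : Type*} [MeasurableSpace α] [NormedAddCommGroup F]
    {μ : Measure α} {f : α → F} (hf : MemLp f 2 μ) :
    eLpNorm f 2 μ ^ 2 = .ofReal (∫ x, ‖f x‖ ^ 2 ∂μ) := by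
  rw [hf.eLpNorm_eq_integral_rpow_norm (by norm_num) (by norm_num), ENNReal.toReal_ofNat,
    ← ENNReal.ofReal_pow (by positivity), ← Real.rpow_natCast, ← Real.rpow_mul (by positivity)]
  simp

theorem IsMixedSolution.exists_sq_eLpNorm_bracket_smul_le (hΩ : IsOpen Ω)
    (hΓ : frontier Ω \ closure Γ₂ ⊆ Γ₁) {β : ℝ} (hβ : 1 / 4 < β) :
    ∃ M : ℝ≥0, ∀ ρ z Z, Integrable ρ (volume.restrict Ω) → IsMixedSolution Ω Γ₁ Γ₂ ρ 0 0 z →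
      HasWeakGradient Ω z Z →
      eLpNorm (fun x => (1 + z x ^ 2) ^ (-β) • Z x) 2 (volume.restrict Ω) ^ 2 ≤
        M * eLpNorm ρ 1 (volume.restrict Ω) := by
  obtain ⟨M, hM⟩ := exists_abs_bracketPrim_le (a := 2 * β) (by linarith)
  refine ⟨M, fun ρ z Z hρ hz hZ => ?_⟩
  obtain ⟨g, hg, -⟩ := hz.dirichlet
  obtain ⟨hw, hW⟩ := hg.comp hΩ hZ (contDiff_bracketPrim β)
    (lipschitzWith_bracketPrim (by linarith)) (bracketPrim_zero β)
  have hW₂ := hw.1.memLp_of_hasWeakGradient hΩ hW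
  have henergy := hz.integral_deriv_mul_sq_le hΩ hΓ hZ hρ (contDiff_bracketPrim (2 * β))
    (lipschitzWith_bracketPrim (by linarith)) (bracketPrim_zero _) hM
  simp only [deriv_bracketPrim] at hW₂ henergy
  have hsq (x : E N) :
      ‖(1 + z x ^ 2) ^ (-β) • Z x‖ ^ 2 = (1 + z x ^ 2) ^ (-(2 * β)) * ‖Z x‖ ^ 2 := by
    rw [norm_smul, mul_pow, Real.norm_of_nonneg (by positivity),
      ← Real.rpow_mul_natCast (by positivity), Nat.cast_ofNat, neg_mul, mul_comm β]
  rw [sq_eLpNorm_two_eq_ofReal_integral hW₂, eLpNorm_one_eq_lintegral_enorm,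
    ← ofReal_integral_norm_eq_lintegral_enorm hρ, ← ENNReal.ofReal_coe_nnreal,
    ← ENNReal.ofReal_mul M.coe_nonneg]
  simpa only [hsq] using ENNReal.ofReal_le_ofReal henergy

end Energy

section SobolevBound

variable {N : ℕ} {Ω Γ₁ Γ₂ S : Set (E N)} {u : E N → ℝ} {p q : ℝ≥0∞}

lemma MemW1.mono_exponent (hΩ : Bornology.IsBounded Ω) (hpq : p ≤ q) (hu : MemW1 Ω q u) :
    MemW1 Ω p u := by
  have := isFiniteMeasure_restrict_of_isBounded hΩ
  obtain ⟨hu, G, hG, hG'⟩ := hu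
  exact ⟨hu.mono_exponent hpq, G, hG, hG'.mono_exponent hpq⟩

lemma MemW1.w1Norm_ne_top (hu : MemW1 Ω p u) : w1Norm Ω p u ≠ ⊤ := by
  obtain ⟨hu, G, hG, hG'⟩ := hu
  have := hu.eLpNorm_ne_top
  have := hG'.eLpNorm_ne_top
  exact ne_top_of_le_ne_top (by finiteness) (hG.w1Norm_le p)

/-- `β > 1/4` makes the test function `∫ (1 + s²)^(-2β)` bounded, and `m * κ` is an exponent
below the critical one. -/
lemma exists_exponents (hN : 2 ≤ N) {q : ℝ} (hq : 1 ≤ q) (hqN : q < (N : ℝ) / ((N : ℝ) - 1)) :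
    ∃ m β κ : ℝ, m.HolderTriple 2 q ∧ 2 * q ≤ m ∧ 2 ≤ m * κ ∧
      1 / 2 - 1 / (N : ℝ) < 1 / (m * κ) ∧ 1 / 4 < β ∧ 0 < κ ∧ (1 / 2 - β) * κ = β := by
  have hN₂ : (2 : ℝ) ≤ N := by exact_mod_cast hN
  rw [lt_div_iff₀ (by linarith)] at hqN
  have hq₂ : q < 2 := by nlinarith
  obtain ⟨m, hm⟩ : ∃ m, m = 2 * q / (2 - q) := ⟨_, rfl⟩
  have hm₀ : 0 < m := hm ▸ div_pos (by linarith) (by linarith)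
  have hHolder : m⁻¹ + 2⁻¹ = q⁻¹ := by
    have : 2 - q ≠ 0 := by linarith
    rw [hm]
    field_simp
    ring
  have hqm : 2 * q ≤ m := by
    rw [hm, le_div_iff₀ (by linarith)]
    nlinarith
  have hcrit : 1 / 2 - 1 / (N : ℝ) < 1 / m := by
    have : 1 - (N : ℝ)⁻¹ < q⁻¹ := by
      field_simp
      linarith
    simp only [one_div]
    linarith
  obtain ⟨t, htN, htm⟩ := exists_between hcrit
  have ht₀ : 0 < t := by
    have : 1 / (N : ℝ) ≤ 1 / 2 := one_div_le_one_div_of_le (by norm_num) hN₂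
    linarith
  have hmt : m < 1 / t := (lt_one_div ht₀ hm₀).1 htm
  obtain ⟨κ, hκ⟩ : ∃ κ, κ = 1 / t / m := ⟨_, rfl⟩
  have hκ₁ : 1 < κ := by rwa [hκ, one_lt_div hm₀]
  have hmκ : m * κ = 1 / t := by rw [hκ, mul_div_cancel₀ _ hm₀.ne']
  refine ⟨m, κ / (2 * (1 + κ)), κ, ⟨hHolder, hm₀, two_pos⟩, hqm, by linarith,
    by rwa [hmκ, one_div_one_div], ?_, by linarith, ?_⟩
  · rw [div_lt_div_iff₀ (by norm_num) (by linarith)]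
    linarith
  · have : 1 + κ ≠ 0 := by linarith
    field_simp
    ring

lemma IsBoundedLipschitzDomain.exists_eLpNorm_bracket_le (hN : 1 ≤ N)
    (hΩ : IsBoundedLipschitzDomain Ω) (hS : surf Ω S ≠ 0) {m β κ : ℝ} (hm : 1 ≤ m)
    (hmκ : 2 ≤ m * κ) (hmκN : 1 / 2 - 1 / (N : ℝ) < 1 / (m * κ)) (hβ : 0 ≤ β) (hκ : 0 < κ)
    (hβκ : (1 / 2 - β) * κ = β) (D : ℝ≥0) :
    ∃ C : ℝ≥0, ∀ z Z g, HasTrace Ω z g → HasWeakGradient Ω z Z →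
      g =ᵐ[(surf Ω).restrict S] 0 →
      eLpNorm (fun x => (1 + z x ^ 2) ^ (-β) • Z x) 2 (volume.restrict Ω) ≤ D →
        eLpNorm (fun x => (1 + z x ^ 2) ^ β) (.ofReal m) (volume.restrict Ω) ≤ C := by
  have := isFiniteMeasure_restrict_of_isBounded hΩ.isBounded
  obtain ⟨K, hK⟩ := hΩ.exists_eLpNorm_le_of_trace_eq_zero hN hmκ hmκN hS
  have hfin : .ofReal (2 ^ β) * (volume.restrict Ω) univ ^ (1 / m) +
      .ofReal (√2 ^ κ) * (K * D : ℝ≥0∞) ^ κ ≠ ⊤ := by finiteness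
  refine ⟨_, fun z Z g hg hZ hg₀ hD =>
    le_of_le_of_eq ?_ (ENNReal.coe_toNNReal hfin).symm⟩
  have hz := hg.1.1.aestronglyMeasurable
  obtain ⟨hw, hW⟩ := hg.comp hΩ.isOpen hZ (contDiff_bracketPrim β)
    (lipschitzWith_bracketPrim hβ) (bracketPrim_zero β)
  have hSobolev := hK _ _ _ hw hW (compLp_ae_eq_zero _ _ hg₀)
  simp only [deriv_bracketPrim] at hSobolev
  grw [eLpNorm_bracket_le hz hβ hκ hβκ hm, hSobolev, hD]

theorem IsBoundedLipschitzDomain.exists_w1Norm_le_of_eLpNorm_bracket_smul_le (hN : 2 ≤ N)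
    (hΩ : IsBoundedLipschitzDomain Ω) (hS : surf Ω S ≠ 0) {q : ℝ} (hq : 1 ≤ q)
    (hqN : q < (N : ℝ) / ((N : ℝ) - 1)) :
    ∃ β : ℝ, 1 / 4 < β ∧ ∀ D : ℝ≥0, ∃ C : ℝ≥0, ∀ z Z g, HasTrace Ω z g →
      HasWeakGradient Ω z Z → g =ᵐ[(surf Ω).restrict S] 0 →
      eLpNorm (fun x => (1 + z x ^ 2) ^ (-β) • Z x) 2 (volume.restrict Ω) ≤ D →
        w1Norm Ω (.ofReal q) z ≤ C := by
  have := isFiniteMeasure_restrict_of_isBounded hΩ.isBounded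
  obtain ⟨m, β, κ, hHolder, hqm, hmκ, hmκN, hβ, hκ, hβκ⟩ := exists_exponents hN hq hqN
  have hqβm : q / (2 * β) ≤ m := by
    rw [div_le_iff₀ (by linarith)]
    nlinarith
  have hexp : 0 ≤ 1 / (q / (2 * β)) - 1 / m :=
    sub_nonneg.2 (one_div_le_one_div_of_le (by positivity) hqβm)
  refine ⟨β, hβ, fun D => ?_⟩
  obtain ⟨Y, hY⟩ := hΩ.exists_eLpNorm_bracket_le (by lia) hS (by linarith) hmκ hmκN
    (by linarith) hκ hβκ D
  have hfin : (Y * (volume.restrict Ω) univ ^ (1 / (q / (2 * β)) - 1 / m)) ^ (1 / (2 * β)) +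
      N * (Y * D : ℝ≥0∞) ≠ ⊤ := by finiteness
  refine ⟨_, fun z Z g hg hZ hg₀ hD =>
    le_of_le_of_eq ?_ (ENNReal.coe_toNNReal hfin).symm⟩
  have hz := hg.1.1.aestronglyMeasurable
  have hbracket := hY z Z g hg hZ hg₀ hD
  have hTriple : ENNReal.HolderTriple (.ofReal m) 2 (.ofReal q) := by
    simpa using hHolder.ennrealOfReal
  have hgrad := eLpNorm_le_eLpNorm_bracket_mul (β := β) (p := .ofReal m) (q := 2)
    (r := .ofReal q) hz hZ.locIntGrad.aestronglyMeasurable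
  grw [hZ.w1Norm_le, eLpNorm_le_eLpNorm_bracket hz (by linarith) (by linarith) hqβm, hgrad,
    hbracket, hD]

theorem IsMixedSolution.exists_w1Norm_le (hN : 2 ≤ N) (hΩ : IsBoundedLipschitzDomain Ω)
    (hΓ : frontier Ω \ closure Γ₂ ⊆ Γ₁) (hΓ₁ : surf Ω Γ₁ ≠ 0) {q : ℝ} (hq : 1 ≤ q)
    (hqN : q < (N : ℝ) / ((N : ℝ) - 1)) (V : ℝ≥0) :
    ∃ C : ℝ≥0, ∀ ρ z, Integrable ρ (volume.restrict Ω) → eLpNorm ρ 1 (volume.restrict Ω) ≤ V →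
      IsMixedSolution Ω Γ₁ Γ₂ ρ 0 0 z → w1Norm Ω (.ofReal q) z ≤ C := by
  obtain ⟨β, hβ, hbound⟩ :=
    hΩ.exists_w1Norm_le_of_eLpNorm_bracket_smul_le hN hΓ₁ hq hqN
  obtain ⟨M, henergy⟩ := exists_sq_eLpNorm_bracket_smul_le hΩ.isOpen hΓ hβ
  obtain ⟨C, hC⟩ := hbound (NNReal.sqrt (M * V))
  refine ⟨C, fun ρ z hρ hρV hz => ?_⟩
  obtain ⟨g, hg, hg₀⟩ := hz.dirichlet
  obtain ⟨Z, hZ, -⟩ := hz.weak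
  refine hC z Z g hg hZ hg₀ ((ENNReal.pow_le_pow_left_iff two_ne_zero).1 ?_)
  grw [henergy ρ z Z hρ hz hZ, hρV, ← ENNReal.coe_pow, NNReal.sq_sqrt, ENNReal.coe_mul]

theorem IsMixedSolution.exists_w1Norm_sub_le (hN : 2 ≤ N) (hΩ : IsBoundedLipschitzDomain Ω)
    (hΓ : frontier Ω \ closure Γ₂ ⊆ Γ₁) (hΓ₁ : surf Ω Γ₁ ≠ 0) {q : ℝ} (hq : 1 ≤ q)
    (hqN : q < (N : ℝ) / ((N : ℝ) - 1)) (V : ℝ≥0) :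
    ∃ C : ℝ≥0, ∀ f₁ (f₂ : HNegHalf Ω Γ₂) ρ ρ' u u',
      MemLp ρ 2 (volume.restrict Ω) → MemLp ρ' 2 (volume.restrict Ω) →
      eLpNorm ρ 1 (volume.restrict Ω) ≤ V → eLpNorm ρ' 1 (volume.restrict Ω) ≤ V →
      IsMixedSolution Ω Γ₁ Γ₂ ρ f₁ f₂ u → IsMixedSolution Ω Γ₁ Γ₂ ρ' f₁ f₂ u' →
        w1Norm Ω (.ofReal q) (fun x => u x - u' x) ≤ C := by
  have := isFiniteMeasure_restrict_of_isBounded hΩ.isBounded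
  obtain ⟨C, hC⟩ := exists_w1Norm_le hN hΩ hΓ hΓ₁ hq hqN (V + V)
  refine ⟨C, fun f₁ f₂ ρ ρ' u u' hρ hρ' hρV hρV' hu hu' => ?_⟩
  refine hC _ _ ((hρ.sub hρ').integrable one_le_two) ?_ (hu.sub hΩ.isOpen hu' hρ hρ')
  rw [ENNReal.coe_add]
  exact (eLpNorm_sub_le hρ.1 hρ'.1 le_rfl).trans (add_le_add hρV hρV')

end SobolevBound

end MixedPoisson

end

theorem mainTheorem9_general {N : ℕ} (hN : 2 ≤ N) (Ω Γ₁ Γ₂ : Set (MixedPoisson.E N))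
    (hΩ : MixedPoisson.IsBoundedLipschitzDomain Ω) (hΓ : frontier Ω \ closure Γ₂ ⊆ Γ₁)
    (hΓ₁ : 0 < MixedPoisson.surf Ω Γ₁) (f₁ : MixedPoisson.E N → ℝ)
    (f₂ : MixedPoisson.HNegHalf Ω Γ₂)
    (μ : ℕ → MixedPoisson.E N → ℝ) (hμ : ∀ n, MemLp (μ n) 2 (volume.restrict Ω))
    (hμ_bdd : MixedPoisson.BoundedVariation Ω μ ∨ ∃ ν, MixedPoisson.WeakStarTendsto Ω μ ν)
    (u : ℕ → MixedPoisson.E N → ℝ)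
    (hu : ∀ n, MixedPoisson.IsMixedSolution Ω Γ₁ Γ₂ (μ n) f₁ f₂ (u n))
    (q : ℝ) (hq : 1 ≤ q) (hqN : q < (N : ℝ) / ((N : ℝ) - 1)) :
    ∃ C : ℝ≥0, ∀ n, MixedPoisson.MemW1 Ω (ENNReal.ofReal q) (u n) ∧
      MixedPoisson.w1Norm Ω (ENNReal.ofReal q) (u n) ≤ C := by
  have := MixedPoisson.isFiniteMeasure_restrict_of_isBounded hΩ.isBounded
  obtain ⟨V, hV⟩ : MixedPoisson.BoundedVariation Ω μ :=
    hμ_bdd.elim id fun ⟨_, hν⟩ => hν.boundedVariation fun n => (hμ n).integrable one_le_two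
  have hq₂ : ENNReal.ofReal q ≤ 2 := by
    have hN₂ : (2 : ℝ) ≤ N := by exact_mod_cast hN
    rw [lt_div_iff₀ (by linarith)] at hqN
    simpa using ENNReal.ofReal_le_ofReal (show q ≤ 2 by nlinarith)
  have hW (n : ℕ) : MixedPoisson.MemW1 Ω (.ofReal q) (u n) :=
    (hu n).memH1.mono_exponent hΩ.isBounded hq₂
  obtain ⟨C, hC⟩ := MixedPoisson.IsMixedSolution.exists_w1Norm_sub_le hN hΩ hΓ hΓ₁.ne' hq hqN V
  refine ⟨C + (MixedPoisson.w1Norm Ω (.ofReal q) (u 0)).toNNReal, fun n => ⟨hW n, ?_⟩⟩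
  rw [ENNReal.coe_add, ENNReal.coe_toNNReal (hW 0).w1Norm_ne_top]
  have htriangle := MixedPoisson.w1Norm_add_le (Ω := Ω) (ENNReal.one_le_ofReal.2 hq)
    (fun x => u n x - u 0 x) (u 0)
  simp only [sub_add_cancel] at htriangle
  grw [htriangle, hC f₁ f₂ _ _ _ _ (hμ n) (hμ 0) (hV n) (hV 0) (hu n) (hu 0)]

theorem mainTheorem9 {N : ℕ} (hN : 3 ≤ N) (Ω Γ₁ Γ₂ : Set (MixedPoisson.E N))
    (hΩ : MixedPoisson.IsBoundedLipschitzDomain Ω)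
    (hΓ : MixedPoisson.IsBoundaryDecomposition Ω Γ₁ Γ₂)
    (hΓ₁ : 0 < MixedPoisson.surf Ω Γ₁)
    (f₁ : MixedPoisson.E N → ℝ) (hf₁ : MixedPoisson.MemHHalfOn Ω Γ₁ f₁)
    (f₂ : MixedPoisson.HNegHalf Ω Γ₂)
    (μ : ℕ → MixedPoisson.E N → ℝ) (hμ : ∀ n, MemLp (μ n) ∞ (volume.restrict Ω))
    (hμ_bdd : MixedPoisson.BoundedVariation Ω μ ∨ ∃ ν, MixedPoisson.WeakStarTendsto Ω μ ν)
    (u : ℕ → MixedPoisson.E N → ℝ)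
    (hu : ∀ n, MixedPoisson.IsMixedSolution Ω Γ₁ Γ₂ (μ n) f₁ f₂ (u n)) :
    ∀ q : ℝ, 1 ≤ q → q < (N : ℝ) / ((N : ℝ) - 1) →
      ∃ C : ℝ≥0, ∀ n, MixedPoisson.MemW1 Ω (ENNReal.ofReal q) (u n) ∧
        MixedPoisson.w1Norm Ω (ENNReal.ofReal q) (u n) ≤ C := by
  have := MixedPoisson.isFiniteMeasure_restrict_of_isBounded hΩ.isBounded
  exact mainTheorem9_general (by lia) Ω Γ₁ Γ₂ hΩ
    (by rw [sdiff_subset_iff, ← hΓ.closure_right, union_comm]) hΓ₁ f₁ f₂ μ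
    (fun n => (hμ n).mono_exponent le_top) hμ_bdd u hu
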